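/- **Setting (bandit PCA).** Let $d\ge 1$ and $T\ge 2$. In each round $t=1,\dots,T$ a learner picks, at random, a unit vector $w_t\in\mathbb R^d$; a (possibly random) environment picks a symmetric matrix $L_t\in\mathbb R^{d\times d}$ of spectral norm at most $1$, which may depend on the whole history except on the draw of $w_t$; the learner incurs and observes only $\ell_t=\langle w_tw_t^{\mathsf T},L_t\rangle=\operatorname{tr}(w_tw_t^{\mathsf T}L_t)$. The regret is $$\mathrm{regret}_T=\max_{\|u\|=1}\ \sum_{t=1}^T\mathbb E\,\langle w_tw_t^{\mathsf T}-uu^{\mathsf T},L_t\rangle .$$ **Algorithm (online mirror descent with sparse sampling, learning rate $\eta$, exploration rate $\gamma$).** Let $W_1=I/d$. In round $t$, take an eigendecomposition $W_t=\sum_i\mu_iu_iu_i^{\mathsf T}$ with $u_1,\dots,u_d$ orthonormal, and put $\lambda_i=(1-\gamma)\mu_i+\gamma/d$. Given the past, draw $I,J$ independently from $\lambda$ and a uniform sign $s\in\{-1,1\}$. * If $I=J$, play $w_t=u_I$ and put $\widetilde L_t=\frac{\ell_t}{\lambda_I^2}u_Iu_I^{\mathsf T}$. * If $I\ne J$, play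 $w_t=\frac1{\sqrt2}(u_I+su_J)$ and put $\widetilde L_t=\frac{s\,\ell_t}{2\lambda_I\lambda_J}(u_Iu_J^{\mathsf T}+u_Ju_I^{\mathsf T})$. Then set $W_{t+1}=(W_t^{-1}+\eta\widetilde L_t+\beta I)^{-1}$, with $\beta\in\mathbb R$ such that $W_{t+1}$ is positive definite of trace $1$. **Statement.** There is an absolute constant $C>0$ such that the following holds for all $d\ge1$, all $T\ge2$ and every such environment. Let $r>0$, known to the algorithm, satisfy $r\ge\frac1T\sum_{t=1}^T\mathbb E\|L_t\|_F^2$, and run the algorithm with $$\eta=\min\Big\{\sqrt{\tfrac{\log T}{rT}},\ \tfrac1{2d}\Big\},\qquad \gamma=d\,\eta .$$ Then $$\mathrm{regret}_T\le C\,d\sqrt{rT\log T}\quad\text{if } r\ge1,\qquad\qquad \mathrm{regret}_T\le C\,d\sqrt{T\log T}\quad\text{if } r<1 .$$ In particular, if every $L_t$ has rank at most one (as in classical PCA, where $L_t=-x_tx_t^{\mathsf T}$ with $\|x_t\|\le1$), the algorithm run with $r=1$ satisfies $\mathrm{regret}_T\le C\,d\sqrt{T\log T}$. -/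

import Mathlib

open MeasureTheory

noncomputable section

namespace BanditPCA

/-- The inner product `⟨A, B⟩ = tr(Aᵀ B)` of square matrices. -/
def frobInner {d : ℕ} (A B : Matrix (Fin d) (Fin d) ℝ) : ℝ :=
  (A.transpose * B).trace

/-- The Frobenius norm `‖A‖_F = √⟨A, A⟩`. -/
def frobNorm {d : ℕ} (A : Matrix (Fin d) (Fin d) ℝ) : ℝ :=
  Real.sqrt (frobInner A A)

/-- The spectral norm: the operator norm with respect to the Euclidean norm. -/
def specNorm {d : ℕ} (A : Matrix (Fin d) (Fin d) ℝ) : ℝ :=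
  ‖Matrix.toEuclideanCLM (𝕜 := ℝ) A‖

/-- The rank-one matrix `v vᵀ`. -/
def outer {d : ℕ} (v : Fin d → ℝ) : Matrix (Fin d) (Fin d) ℝ :=
  Matrix.vecMulVec v v

/-- The random sign, as a real number: `+1` for `true` and `-1` for `false`. -/
def signVal (s : Bool) : ℝ := if s then 1 else -1

/-- `W = ∑ i, μ i • u i (u i)ᵀ` with `u` an orthonormal basis. -/
def IsEigendecomposition {d : ℕ} (W : Matrix (Fin d) (Fin d) ℝ)
    (μ : Fin d → ℝ) (u : Fin d → Fin d → ℝ) : Prop :=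
  (∀ i j, u i ⬝ᵥ u j = if i = j then 1 else 0) ∧ W = ∑ i, μ i • outer (u i)

/-- The sampling probabilities: the eigenvalues mixed with the uniform distribution. -/
def mixed {d : ℕ} (γ : ℝ) (μ : Fin d → ℝ) (i : Fin d) : ℝ :=
  (1 - γ) * μ i + γ * (1 / (d : ℝ))

/-- Sparse sampling: the vector played when the indices `i`, `j` and the sign `s` are drawn. -/
def sparseVector {d : ℕ} (u : Fin d → Fin d → ℝ) (i j : Fin d) (s : Bool) : Fin d → ℝ :=
  if i = j then u i else (1 / Real.sqrt 2) • (u i + signVal s • u j)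

/-- Sparse sampling: the estimate of the loss matrix that is built from the observed loss `ℓ`. -/
def sparseEstimate {d : ℕ} (lam : Fin d → ℝ) (u : Fin d → Fin d → ℝ)
    (i j : Fin d) (s : Bool) (ℓ : ℝ) : Matrix (Fin d) (Fin d) ℝ :=
  if i = j then (ℓ / lam i ^ 2) • outer (u i)
  else (signVal s * ℓ / (2 * lam i * lam j)) •
    (Matrix.vecMulVec (u i) (u j) + Matrix.vecMulVec (u j) (u i))

/-- The initial density matrix `I / d`. -/
def initial (d : ℕ) : Matrix (Fin d) (Fin d) ℝ := (1 / (d : ℝ)) • 1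

/-- `W'` is the density matrix `(W⁻¹ + η • Lt + β • I)⁻¹`, with `β` such that its trace is one. -/
def IsUpdate {d : ℕ} (η : ℝ) (W Lt W' : Matrix (Fin d) (Fin d) ℝ) : Prop :=
  W'.PosDef ∧ W'.trace = 1 ∧
    ∃ β : ℝ, W' = (W⁻¹ + η • Lt + β • (1 : Matrix (Fin d) (Fin d) ℝ))⁻¹

open Classical in
/-- The mirror descent update; if there were no admissible `β`, the algorithm would restart. -/
def update {d : ℕ} (η : ℝ) (W Lt : Matrix (Fin d) (Fin d) ℝ) : Matrix (Fin d) (Fin d) ℝ :=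
  if h : ∃ W', IsUpdate η W Lt W' then h.choose else initial d

/-- `T` rounds of the interaction between online mirror descent with sparse sampling (learning
rate `η`, exploration rate `γ`) and an adaptive, possibly random environment, on a probability
space `(Ω, P)`. Rounds are numbered `0, …, T - 1`. The σ-algebra `ℱ t` stands for the history of
rounds `0, …, t - 1` together with the choice that the environment makes in round `t`; the
learner's draws of round `t` are made independently of it, from the mixed eigenvalues.
The eigendecompositions are arbitrary (measurable) ones. -/
structure SparseRun {Ω : Type*} [mΩ : MeasurableSpace Ω] (P : Measure Ω)
    (d T : ℕ) (η γ : ℝ) where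
  /-- the history -/
  ℱ : Filtration ℕ mΩ
  /-- the loss matrices -/
  L : ℕ → Ω → Matrix (Fin d) (Fin d) ℝ
  /-- the density matrices -/
  W : ℕ → Ω → Matrix (Fin d) (Fin d) ℝ
  /-- the eigenvalues of the density matrices -/
  μ : ℕ → Ω → Fin d → ℝ
  /-- the eigenvectors of the density matrices -/
  u : ℕ → Ω → Fin d → Fin d → ℝ
  /-- the first index drawn -/
  I : ℕ → Ω → Fin d
  /-- the second index drawn -/
  J : ℕ → Ω → Fin d
  /-- the sign drawn; it is not used when both indices agree -/
  s : ℕ → Ω → Bool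
  loss_symm : ∀ t < T, ∀ ω, (L t ω).IsSymm
  loss_norm_le : ∀ t < T, ∀ ω, specNorm (L t ω) ≤ 1
  loss_measurable : ∀ t < T, ∀ i j, Measurable[ℱ t] fun ω => L t ω i j
  eigenvalue_measurable : ∀ t < T, ∀ i, Measurable[ℱ t] fun ω => μ t ω i
  eigenvector_measurable : ∀ t < T, ∀ i j, Measurable[ℱ t] fun ω => u t ω i j
  draw_measurable : ∀ t < T, Measurable[ℱ (t + 1)] fun ω => (I t ω, J t ω, s t ω)
  eigendecomposition : ∀ t < T, ∀ ω, IsEigendecomposition (W t ω) (μ t ω) (u t ω)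
  draw_law : ∀ t < T, ∀ (i j : Fin d) (b : Bool),
    P[Set.indicator {ω | I t ω = i ∧ J t ω = j ∧ s t ω = b} (fun _ => (1 : ℝ)) | ℱ t] =ᵐ[P]
      fun ω => mixed γ (μ t ω) i * mixed γ (μ t ω) j * (1 / 2)
  W_zero : ∀ ω, W 0 ω = initial d
  W_succ : ∀ t, t + 1 < T → ∀ ω, W (t + 1) ω = update η (W t ω)
    (sparseEstimate (mixed γ (μ t ω)) (u t ω) (I t ω) (J t ω) (s t ω)
      (frobInner (outer (sparseVector (u t ω) (I t ω) (J t ω) (s t ω))) (L t ω)))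

namespace SparseRun

variable {Ω : Type*} [MeasurableSpace Ω] {P : Measure Ω} {d T : ℕ} {η γ : ℝ}

/-- The vector played by the learner in round `t`. -/
def w (X : SparseRun P d T η γ) (t : ℕ) (ω : Ω) : Fin d → ℝ :=
  sparseVector (X.u t ω) (X.I t ω) (X.J t ω) (X.s t ω)

/-- The total expected regret: the maximum over unit vectors `v` of
`∑ t, E ⟨w_t w_tᵀ - v vᵀ, L_t⟩`. -/
def regret (X : SparseRun P d T η γ) : ℝ :=
  ⨆ v : {v : Fin d → ℝ // v ⬝ᵥ v = 1},
    ∑ t ∈ Finset.range T, ∫ ω, frobInner (outer (X.w t ω) - outer v.1) (X.L t ω) ∂P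

/-- The average expected squared Frobenius norm of the losses. -/
def avgSqNorm (X : SparseRun P d T η γ) : ℝ :=
  (1 / (T : ℝ)) * ∑ t ∈ Finset.range T, ∫ ω, frobNorm (X.L t ω) ^ 2 ∂P

end SparseRun

/-- The learning rate `min {√(log T / (r T)), 1 / (2 d)}`. -/
def learningRate (d T : ℕ) (r : ℝ) : ℝ :=
  min (Real.sqrt (Real.log T / (r * T))) (1 / (2 * (d : ℝ)))

end BanditPCA

end

namespace BanditPCA

open Matrix

variable {d : ℕ}

/-! The algorithm is mirror descent with the log-determinant barrier. For a comparator `U` of trace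
one, consider the potential `log det W + tr (U W⁻¹)`. By `mirror_descent_step`, each update lowers
it by at least `η tr ((W - U) L̃)`, up to twice the second-order term `tr ((W η L̃)²)`. The
comparator `v vᵀ` is singular for `d ≥ 2`, so it is mixed with weight `1 / T` of `I / d`; the
potential then drops by at most `d log T` overall, at the price of a bias `2 / T` per round. This is
the pathwise bound `sum_trace_estimate_le`.

The second-order expansion of `log det` needs `η L̃ ≥ -W⁻¹ / 2`. Exploration at rate `γ = d η ≤ 1 /
2` gives `λ i ≥ μ i / 2 + η`, hence `λ i ² ≥ 2 η μ i` (`isTame`), which is exactly what this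
semidefinite bound requires (`posSemidef_half_inv_add_sparseEstimate`).

In expectation the estimate is unbiased (`sum_trace_mul_sparseEstimate`), exploration costs at most
`2 d η ‖L‖_F` per round, and in the second-order term the sampling probabilities cancel the
denominators, leaving `4 d η² ‖L‖_F²` (`sum_stability_le`). Together these bound the regret by `d
log T / η + 8 d η ∑ E‖L‖_F² + 2 d η ∑ E‖L‖_F + 2`. If the rate is `√(log T / (r T))`, this is the
claim; if it is capped at `1 / (2 d)`, then `√(r T) ≤ 2 d √(log T)` and the trivial bound `2 ∑
E‖L‖_F` suffices. -/

theorem exists_orthogonal_diagonalization {A : Matrix (Fin d) (Fin d) ℝ} (hA : A.IsHermitian) :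
    ∃ (a : Fin d → ℝ) (Q : Matrix (Fin d) (Fin d) ℝ),
      Q * Qᵀ = 1 ∧ Qᵀ * Q = 1 ∧ A = Qᵀ * diagonal a * Q := by
  refine ⟨hA.eigenvalues, star (hA.eigenvectorUnitary : Matrix (Fin d) (Fin d) ℝ), ?_, ?_, ?_⟩
  · have := Unitary.coe_star_mul_self hA.eigenvectorUnitary
    simpa [star_eq_conjTranspose, conjTranspose_eq_transpose_of_trivial] using this
  · have := Unitary.coe_mul_star_self hA.eigenvectorUnitary
    simpa [star_eq_conjTranspose, conjTranspose_eq_transpose_of_trivial] using this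
  · have := hA.spectral_theorem
    rw [Unitary.conjStarAlgAut_apply] at this
    conv_lhs => rw [this]
    simp [star_eq_conjTranspose, conjTranspose_eq_transpose_of_trivial]

/-! ### Orthogonal conjugation and log-determinant inequalities. -/

section Conjugation

variable {Q : Matrix (Fin d) (Fin d) ℝ}

theorem det_conj (hQ : Q * Qᵀ = 1) (A : Matrix (Fin d) (Fin d) ℝ) :
    (Qᵀ * A * Q).det = A.det := by
  rw [det_mul, det_mul, mul_comm, ← mul_assoc, ← det_mul, hQ, det_one, one_mul]

theorem trace_conj (hQ : Q * Qᵀ = 1) (A : Matrix (Fin d) (Fin d) ℝ) :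
    (Qᵀ * A * Q).trace = A.trace := by
  rw [trace_mul_comm, ← Matrix.mul_assoc, hQ, Matrix.one_mul]

theorem conj_mul_conj (hQ : Q * Qᵀ = 1) (A B : Matrix (Fin d) (Fin d) ℝ) :
    (Qᵀ * A * Q) * (Qᵀ * B * Q) = Qᵀ * (A * B) * Q := by
  have : (Qᵀ * A * Q) * (Qᵀ * B * Q) = Qᵀ * A * (Q * Qᵀ) * B * Q := by
    simp only [Matrix.mul_assoc]
  rw [this, hQ]; simp only [Matrix.mul_one, Matrix.mul_assoc]

theorem conj_conj_symm (hQ : Q * Qᵀ = 1) (A : Matrix (Fin d) (Fin d) ℝ) :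
    Q * (Qᵀ * A * Q) * Qᵀ = A := by
  have : Q * (Qᵀ * A * Q) * Qᵀ = (Q * Qᵀ) * A * (Q * Qᵀ) := by simp only [Matrix.mul_assoc]
  rw [this, hQ, Matrix.one_mul, Matrix.mul_one]

theorem posDef_conj_diagonal (hQ' : Qᵀ * Q = 1) {a : Fin d → ℝ} (ha : ∀ i, 0 < a i) :
    (Qᵀ * diagonal a * Q).PosDef := by
  have h := (Matrix.PosDef.diagonal ha).conjTranspose_mul_mul_same (B := Q)
    (fun x y h => by
      have := congrArg (fun z => Qᵀ *ᵥ z) h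
      simpa [mulVec_mulVec, hQ'] using this)
  simpa [conjTranspose_eq_transpose_of_trivial] using h

theorem le_of_posSemidef_conj_diagonal_sub (hQ : Q * Qᵀ = 1) {a : Fin d → ℝ} {c : ℝ}
    (h : (Qᵀ * diagonal a * Q - c • 1).PosSemidef) (i : Fin d) : c ≤ a i := by
  have h1 := (h.mul_mul_conjTranspose_same Q).diag_nonneg (i := i)
  rw [conjTranspose_eq_transpose_of_trivial, Matrix.mul_sub, Matrix.sub_mul,
    conj_conj_symm hQ, Matrix.mul_smul, Matrix.smul_mul, Matrix.mul_one, hQ] at h1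
  simp at h1
  linarith

theorem pos_of_posDef_conj_diagonal (hQ : Q * Qᵀ = 1) {a : Fin d → ℝ}
    (h : (Qᵀ * diagonal a * Q).PosDef) (i : Fin d) : 0 < a i := by
  have h1 := (h.mul_mul_conjTranspose_same (B := Q) (fun x y h => by
      have := congrArg (fun z => z ᵥ* Qᵀ) h
      simpa [vecMul_vecMul, hQ] using this)).diag_pos (i := i)
  rw [conjTranspose_eq_transpose_of_trivial, conj_conj_symm hQ] at h1
  simpa using h1

end Conjugation

theorem PosDef.log_det_le {M : Matrix (Fin d) (Fin d) ℝ} (hM : M.PosDef) :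
    Real.log M.det ≤ M.trace - d := by
  obtain ⟨a, Q, hQ, hQ', rfl⟩ := exists_orthogonal_diagonalization hM.1
  have ha := pos_of_posDef_conj_diagonal hQ hM
  rw [det_conj hQ, trace_conj hQ, det_diagonal, trace_diagonal,
    Real.log_prod (fun i _ => (ha i).ne')]
  calc ∑ i, Real.log (a i) ≤ ∑ i, (a i - 1) :=
        Finset.sum_le_sum fun i _ => Real.log_le_sub_one_of_pos (ha i)
    _ = _ := by simp

theorem PosDef.exists_isUnit_transpose_mul {M : Matrix (Fin d) (Fin d) ℝ} (hM : M.PosDef) :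
    ∃ S : Matrix (Fin d) (Fin d) ℝ, IsUnit S ∧ M = Sᵀ * S := by
  obtain ⟨a, Q, hQ, hQ', rfl⟩ := exists_orthogonal_diagonalization hM.1
  have ha := pos_of_posDef_conj_diagonal hQ hM
  have heq : Qᵀ * diagonal a * Q =
      (diagonal (fun i => √(a i)) * Q)ᵀ * (diagonal (fun i => √(a i)) * Q) := by
    rw [transpose_mul, diagonal_transpose, Matrix.mul_assoc Qᵀ, Matrix.mul_assoc Qᵀ,
      ← Matrix.mul_assoc (diagonal _) (diagonal _) Q, diagonal_mul_diagonal]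
    simp only [Real.mul_self_sqrt (ha _).le]
  refine ⟨_, ?_, heq⟩
  rw [Matrix.isUnit_iff_isUnit_det, isUnit_iff_ne_zero]
  intro h
  have := hM.det_pos
  rw [heq, det_mul, h, mul_zero] at this
  exact this.false

/-- This is the Fenchel inequality for `-log det`. Writing `B = Sᵀ S` and passing to `S A Sᵀ`
reduces it to `log x ≤ x - 1` on eigenvalues. -/
theorem log_det_add_log_det_le {A B : Matrix (Fin d) (Fin d) ℝ} (hA : A.PosDef) (hB : B.PosDef) :
    Real.log A.det + Real.log B.det ≤ (A * B).trace - d := by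
  obtain ⟨S, hS, rfl⟩ := PosDef.exists_isUnit_transpose_mul hB
  have hP : (S * A * Sᵀ).PosDef := by
    have := (IsUnit.posDef_star_right_conjugate_iff (x := A) hS).2 hA
    rwa [star_eq_conjTranspose, conjTranspose_eq_transpose_of_trivial] at this
  have h := PosDef.log_det_le hP
  have h1 : (S * A * Sᵀ).det = A.det * (Sᵀ * S).det := by
    simp only [det_mul]; ring
  have h2 : (S * A * Sᵀ).trace = (A * (Sᵀ * S)).trace := by
    rw [Matrix.mul_assoc, trace_mul_comm, Matrix.mul_assoc]
  rwa [h1, h2, Real.log_mul hA.det_pos.ne' hB.det_pos.ne'] at h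

/-- The bound `1 - x⁻¹ ≤ log x` exceeds the left side by `(x - 1)² (2x - 1) / x`, which explains the
threshold `1 / 2`. -/
theorem sub_two_mul_sq_le_log {x : ℝ} (hx : 1 / 2 ≤ x) :
    (x - 1) - 2 * (x - 1) ^ 2 ≤ Real.log x := by
  have hx0 : 0 < x := by linarith
  refine le_trans ?_ (Real.one_sub_inv_le_log_of_pos hx0)
  have : 1 - x⁻¹ - ((x - 1) - 2 * (x - 1) ^ 2) = (x - 1) ^ 2 * (2 * x - 1) / x := by
    field_simp; ring
  have h2 : 0 ≤ (x - 1) ^ 2 * (2 * x - 1) / x := by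
    have : 0 ≤ 2 * x - 1 := by linarith
    positivity
  linarith

/-- With `W = Sᵀ S`, congruence by `S` turns `W⁻¹` into the identity and `X` into `N = S X Sᵀ`, so
the right side is `log det (1 + N)`. The hypothesis says that the eigenvalues of `1 + N` are at
least `1 / 2`, and the scalar bound applies to each of them. -/
theorem posDef_add_and_log_det_add_ge {W X : Matrix (Fin d) (Fin d) ℝ} (hW : W.PosDef)
    (h : ((1 / 2 : ℝ) • W⁻¹ + X).PosSemidef) :
    (W⁻¹ + X).PosDef ∧ (W * X).trace - 2 * (W * X * (W * X)).trace ≤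
      Real.log W.det + Real.log (W⁻¹ + X).det := by
  have hpos : (W⁻¹ + X).PosDef := by
    have := (hW.inv.smul (show (0 : ℝ) < 1 / 2 by norm_num)).add_posSemidef h
    rw [← add_assoc, ← add_smul] at this
    norm_num at this
    exact this
  refine ⟨hpos, ?_⟩
  obtain ⟨S, hS, hWS⟩ := PosDef.exists_isUnit_transpose_mul hW
  have hSd : IsUnit S.det := (Matrix.isUnit_iff_isUnit_det S).1 hS
  have hSd' : IsUnit Sᵀ.det := by rwa [det_transpose]
  have hone : S * W⁻¹ * Sᵀ = 1 := by
    rw [hWS, Matrix.mul_inv_rev, ← Matrix.mul_assoc, Matrix.mul_nonsing_inv _ hSd, Matrix.one_mul,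
      Matrix.nonsing_inv_mul _ hSd']
  have hP : (S * (W⁻¹ + X) * Sᵀ).PosDef := by
    have := (IsUnit.posDef_star_right_conjugate_iff (x := W⁻¹ + X) hS).2 hpos
    rwa [star_eq_conjTranspose, conjTranspose_eq_transpose_of_trivial] at this
  have hPS : (S * (W⁻¹ + X) * Sᵀ - (1 / 2 : ℝ) • 1).PosSemidef := by
    have := h.mul_mul_conjTranspose_same S
    rw [conjTranspose_eq_transpose_of_trivial] at this
    convert this using 1
    rw [← hone]
    simp only [Matrix.mul_add, Matrix.add_mul, Matrix.mul_smul, Matrix.smul_mul]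
    rw [add_sub_right_comm]
    congr 1
    rw [← one_smul ℝ (S * W⁻¹ * Sᵀ), smul_smul, ← sub_smul]; norm_num
  have hdet : Real.log (S * (W⁻¹ + X) * Sᵀ).det = Real.log W.det + Real.log (W⁻¹ + X).det := by
    rw [← Real.log_mul hW.det_pos.ne' hpos.det_pos.ne']
    congr 1
    rw [hWS]; simp only [det_mul]; ring
  set N := S * X * Sᵀ with hN
  have hPN : S * (W⁻¹ + X) * Sᵀ = 1 + N := by
    rw [Matrix.mul_add, Matrix.add_mul, hone]
  have ht1 : (W * X).trace = N.trace := by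
    rw [hN, hWS, Matrix.mul_assoc S, trace_mul_comm S, Matrix.mul_assoc, trace_mul_comm]
    simp only [Matrix.mul_assoc]
    rw [trace_mul_comm]
    simp only [Matrix.mul_assoc]
  have ht2 : (W * X * (W * X)).trace = (N * N).trace := by
    have : N * N = S * (X * Sᵀ * S * X * Sᵀ) := by rw [hN]; simp only [Matrix.mul_assoc]
    rw [this, trace_mul_comm, hWS]
    have : Sᵀ * S * X * (Sᵀ * S * X) = Sᵀ * (S * X * (Sᵀ * S * X)) := by simp only [Matrix.mul_assoc]
    rw [this, trace_mul_comm, trace_mul_comm]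
    simp only [Matrix.mul_assoc]
    rw [trace_mul_comm]
    simp only [Matrix.mul_assoc]
  rw [← hdet, hPN, ht1, ht2]
  rw [hPN] at hPS hP
  clear_value N
  obtain ⟨a, Q, hQ, hQ', hA⟩ := exists_orthogonal_diagonalization hP.1
  rw [hA] at hPS ⊢
  have ha := le_of_posSemidef_conj_diagonal_sub hQ hPS
  have hN' : N = Qᵀ * diagonal (fun i => a i - 1) * Q := by
    have : N = Qᵀ * diagonal a * Q - Qᵀ * (1 : Matrix (Fin d) (Fin d) ℝ) * Q := by
      rw [← hA, Matrix.mul_one, hQ']; simp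
    rw [this, ← Matrix.sub_mul, ← Matrix.mul_sub, ← diagonal_one, diagonal_sub]
  rw [hN', conj_mul_conj hQ, trace_conj hQ, trace_conj hQ, det_conj hQ, det_diagonal,
    diagonal_mul_diagonal, trace_diagonal, trace_diagonal, Finset.mul_sum, ← Finset.sum_sub_distrib,
    Real.log_prod (fun i _ => by linarith [ha i])]
  refine Finset.sum_le_sum fun i _ => ?_
  have := sub_two_mul_sq_le_log (ha i)
  linarith [this, sq (a i - 1)]

/-- In an eigenbasis the trace is `∑ i, (a i + β)⁻¹`, and the intermediate value theorem applies to
the right of the pole at minus the least eigenvalue. -/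
theorem exists_posDef_add_smul_one_trace_inv (hd : 1 ≤ d) {A : Matrix (Fin d) (Fin d) ℝ}
    (hA : A.IsHermitian) :
    ∃ β : ℝ, (A + β • (1 : Matrix (Fin d) (Fin d) ℝ))⁻¹.PosDef ∧
      (A + β • (1 : Matrix (Fin d) (Fin d) ℝ))⁻¹.trace = 1 := by
  obtain ⟨a, Q, hQ, hQ', rfl⟩ := exists_orthogonal_diagonalization hA
  have : Nonempty (Fin d) := ⟨⟨0, hd⟩⟩
  obtain ⟨i₀, hi₀⟩ := Finite.exists_min a
  have hd' : (1 : ℝ) ≤ d := by exact_mod_cast hd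
  have hcont : ContinuousOn (fun β : ℝ => ∑ i, (a i + β)⁻¹) (Set.Icc (1 - a i₀) (d - a i₀)) := by
    refine continuousOn_finsetSum _ fun i _ => ContinuousOn.inv₀ (by fun_prop) ?_
    intro β hβ
    have := hi₀ i; have := hβ.1
    linarith
  -- At the left endpoint the term of the least eigenvalue alone equals one; at the right endpoint
  -- each of the `d` terms is at most `1 / d`.
  obtain ⟨β, hβ, hβ1⟩ := intermediate_value_Icc' (by linarith) hcont (show (1 : ℝ) ∈ _ by
    constructor
    · calc ∑ i, (a i + (d - a i₀))⁻¹ ≤ ∑ _i : Fin d, (d : ℝ)⁻¹ :=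
            Finset.sum_le_sum fun i _ => by
              have := hi₀ i
              gcongr
              linarith
        _ = 1 := by simp; field_simp
    · have : (a i₀ + (1 - a i₀))⁻¹ ≤ ∑ i, (a i + (1 - a i₀))⁻¹ :=
        Finset.single_le_sum (f := fun i => (a i + (1 - a i₀))⁻¹) (fun i _ => by
          have := hi₀ i
          have : 0 < a i + (1 - a i₀) := by linarith
          positivity) (Finset.mem_univ i₀)
      simpa using this)
  have hpos : ∀ i, 0 < a i + β := fun i => by
    have := hi₀ i; have := hβ.1
    linarith
  have heq : (Qᵀ * diagonal a * Q + β • (1 : Matrix (Fin d) (Fin d) ℝ))⁻¹ =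
      Qᵀ * diagonal (fun i => (a i + β)⁻¹) * Q := by
    have h1 : Qᵀ * diagonal a * Q + β • (1 : Matrix (Fin d) (Fin d) ℝ) =
        Qᵀ * diagonal (fun i => a i + β) * Q := by
      have : β • (1 : Matrix (Fin d) (Fin d) ℝ) = Qᵀ * diagonal (fun _ => β) * Q := by
        rw [← smul_one_eq_diagonal, Matrix.mul_smul, Matrix.smul_mul, Matrix.mul_one, hQ']
      rw [this, ← Matrix.add_mul, ← Matrix.mul_add, diagonal_add]
    rw [h1]
    refine Matrix.inv_eq_right_inv ?_
    rw [conj_mul_conj hQ, diagonal_mul_diagonal]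
    simp only [mul_inv_cancel₀ (hpos _).ne', diagonal_one, Matrix.mul_one, hQ']
  refine ⟨β, ?_, ?_⟩
  · rw [heq]
    exact posDef_conj_diagonal hQ' fun i => inv_pos.2 (hpos i)
  · rw [heq, trace_conj hQ, trace_diagonal]
    exact hβ1

/-- An admissible shift always exists for Hermitian data, so the restart branch of `update` is never
taken. -/
theorem isUpdate_update (hd : 1 ≤ d) {η : ℝ} {W Lt : Matrix (Fin d) (Fin d) ℝ}
    (hW : W.IsHermitian) (hL : Lt.IsHermitian) : IsUpdate η W Lt (update η W Lt) := by
  have hex : ∃ W', IsUpdate η W Lt W' := by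
    have hH : (W⁻¹ + η • Lt).IsHermitian :=
      hW.inv.add (by
        unfold Matrix.IsHermitian
        rw [conjTranspose_smul, hL.eq]; simp)
    obtain ⟨β, h1, h2⟩ := exists_posDef_add_smul_one_trace_inv hd hH
    exact ⟨_, h1, h2, β, rfl⟩
  rw [update, dif_pos hex]
  exact hex.choose_spec

/-- Compare two estimates of `log det (W⁻¹ + η L̃)`: the Fenchel inequality against `W'` from above,
the second-order expansion around `W⁻¹` from below. The unknown shift `β` enters through `tr W'` and
through `tr U`, and cancels because both are one. -/
theorem mirror_descent_step {η : ℝ} {W Lt W' U : Matrix (Fin d) (Fin d) ℝ} (hW : W.PosDef)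
    (hU : U.trace = 1) (h : ((1 / 2 : ℝ) • W⁻¹ + η • Lt).PosSemidef) (hW' : IsUpdate η W Lt W') :
    η * ((W - U) * Lt).trace ≤
      (Real.log W.det + (U * W⁻¹).trace) - (Real.log W'.det + (U * W'⁻¹).trace)
        + 2 * (W * (η • Lt) * (W * (η • Lt))).trace := by
  obtain ⟨hpos, hlog⟩ := posDef_add_and_log_det_add_ge hW h
  obtain ⟨hW'pos, htr, β, hβ⟩ := hW'
  have hunit : IsUnit (W⁻¹ + η • Lt + β • (1 : Matrix (Fin d) (Fin d) ℝ)).det := by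
    have := hW'pos.det_pos
    rw [hβ] at this
    -- A singular matrix has inverse zero by convention, whose determinant is not positive when `d >
    -- 0`; for `d = 0` the determinant is one.
    by_contra hn
    rw [Matrix.nonsing_inv_apply_not_isUnit _ hn] at this
    rcases Nat.eq_zero_or_pos d with rfl | hd
    · exact hn (by simp)
    · have hne : Nonempty (Fin d) := ⟨⟨0, hd⟩⟩
      simp at this
  have hinv : W'⁻¹ = W⁻¹ + η • Lt + β • (1 : Matrix (Fin d) (Fin d) ℝ) := by
    rw [hβ, Matrix.nonsing_inv_nonsing_inv _ hunit]
  have h1 := log_det_add_log_det_le hW'pos hpos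
  have hA : W⁻¹ + η • Lt = W'⁻¹ - β • (1 : Matrix (Fin d) (Fin d) ℝ) := by rw [hinv]; simp
  have h2 : (W' * (W⁻¹ + η • Lt)).trace = d - β := by
    rw [hA, Matrix.mul_sub, Matrix.mul_nonsing_inv _ (isUnit_iff_ne_zero.2 hW'pos.det_pos.ne')]
    simp [htr]
  have h3 : (U * W'⁻¹).trace = (U * W⁻¹).trace + η * (U * Lt).trace + β := by
    rw [hinv]; simp [Matrix.mul_add, hU]
  have h4 : (W * (η • Lt)).trace = η * (W * Lt).trace := by simp
  rw [h4] at hlog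
  rw [h3, Matrix.sub_mul, trace_sub]
  linarith

/-! ### Quadratic forms, matrix norms and coordinates in an orthonormal basis. -/

theorem trace_mul_vecMulVec (M : Matrix (Fin d) (Fin d) ℝ) (a b : Fin d → ℝ) :
    (M * vecMulVec a b).trace = b ⬝ᵥ M *ᵥ a := by
  rw [mul_vecMulVec, trace_vecMulVec, dotProduct_comm]

theorem trace_vecMulVec_mul (M : Matrix (Fin d) (Fin d) ℝ) (a b : Fin d → ℝ) :
    (vecMulVec a b * M).trace = b ⬝ᵥ M *ᵥ a := by
  rw [trace_mul_comm, trace_mul_vecMulVec]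

theorem dotProduct_vecMulVec_mulVec (x a b y : Fin d → ℝ) :
    x ⬝ᵥ vecMulVec a b *ᵥ y = (x ⬝ᵥ a) * (b ⬝ᵥ y) := by
  rw [vecMulVec_mulVec]; simp [mul_comm]

theorem frobInner_outer (x : Fin d → ℝ) (L : Matrix (Fin d) (Fin d) ℝ) :
    frobInner (outer x) L = x ⬝ᵥ L *ᵥ x := by
  rw [frobInner, outer, transpose_vecMulVec, trace_vecMulVec_mul]

theorem frobInner_sub_left (A B L : Matrix (Fin d) (Fin d) ℝ) :
    frobInner (A - B) L = frobInner A L - frobInner B L := by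
  simp [frobInner, Matrix.sub_mul]

theorem frobInner_self (L : Matrix (Fin d) (Fin d) ℝ) :
    frobInner L L = ∑ i, ∑ j, L i j ^ 2 := by
  rw [frobInner, Matrix.trace, Finset.sum_comm]
  simp [Matrix.mul_apply, sq]

theorem frobNorm_nonneg (L : Matrix (Fin d) (Fin d) ℝ) : 0 ≤ frobNorm L := Real.sqrt_nonneg _

theorem frobNorm_sq (L : Matrix (Fin d) (Fin d) ℝ) :
    frobNorm L ^ 2 = ∑ i, ∑ j, L i j ^ 2 := by
  rw [frobNorm, frobInner_self, Real.sq_sqrt]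
  positivity

theorem abs_dotProduct_mulVec_le_specNorm (L : Matrix (Fin d) (Fin d) ℝ) {x y : Fin d → ℝ}
    (hx : x ⬝ᵥ x = 1) (hy : y ⬝ᵥ y = 1) : |x ⬝ᵥ L *ᵥ y| ≤ specNorm L := by
  have hn : ∀ z : Fin d → ℝ, z ⬝ᵥ z = 1 → ‖WithLp.toLp 2 z‖ = 1 := fun z hz => by
    rw [EuclideanSpace.norm_eq, Real.sqrt_eq_one]
    simpa [dotProduct, sq] using hz
  have h := inner_toEuclideanCLM L (WithLp.toLp 2 x) (WithLp.toLp 2 y)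
  simp only at h
  rw [← h]
  calc _ ≤ ‖WithLp.toLp 2 x‖ * ‖toEuclideanCLM (𝕜 := ℝ) L (WithLp.toLp 2 y)‖ :=
        abs_real_inner_le_norm _ _
    _ ≤ ‖WithLp.toLp 2 x‖ * (‖toEuclideanCLM (𝕜 := ℝ) L‖ * ‖WithLp.toLp 2 y‖) := by
        gcongr
        exact ContinuousLinearMap.le_opNorm _ _
    _ = specNorm L := by rw [hn x hx, hn y hy, specNorm]; ring

theorem abs_dotProduct_mulVec_le_frobNorm (L : Matrix (Fin d) (Fin d) ℝ) {x : Fin d → ℝ}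
    (hx : x ⬝ᵥ x = 1) : |x ⬝ᵥ L *ᵥ x| ≤ frobNorm L := by
  refine abs_le_of_sq_le_sq ?_ (frobNorm_nonneg L)
  rw [frobNorm_sq]
  have h1 : x ⬝ᵥ L *ᵥ x = ∑ p : Fin d × Fin d, L p.1 p.2 * (x p.1 * x p.2) := by
    rw [Fintype.sum_prod_type]
    simp only [dotProduct, mulVec, Finset.mul_sum]
    exact Finset.sum_congr rfl fun i _ => Finset.sum_congr rfl fun j _ => by ring
  have h2 : ∑ p : Fin d × Fin d, (x p.1 * x p.2) ^ 2 = 1 := by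
    rw [Fintype.sum_prod_type]
    have : (∑ i, x i ^ 2) = 1 := by rw [← hx]; simp [dotProduct, sq]
    simp only [mul_pow, ← Finset.mul_sum, this, mul_one]
  have h3 := Finset.sum_mul_sq_le_sq_mul_sq Finset.univ
    (fun p : Fin d × Fin d => L p.1 p.2) (fun p => x p.1 * x p.2)
  rw [h2, mul_one, ← h1, Fintype.sum_prod_type] at h3
  exact h3

theorem sum_outer_eq_conj (u : Fin d → Fin d → ℝ) (a : Fin d → ℝ) :
    ∑ i, a i • outer (u i) = (Matrix.of u)ᵀ * diagonal a * Matrix.of u := by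
  ext p q
  rw [Matrix.mul_apply]
  simp only [mul_diagonal, Matrix.sum_apply, outer, vecMulVec_apply, Matrix.smul_apply, smul_eq_mul,
    transpose_apply, of_apply]
  exact Finset.sum_congr rfl fun i _ => by ring

theorem of_mul_transpose {u : Fin d → Fin d → ℝ}
    (hu : ∀ i j, u i ⬝ᵥ u j = if i = j then 1 else 0) :
    Matrix.of u * (Matrix.of u)ᵀ = 1 := by
  ext i j
  rw [Matrix.one_apply, ← hu i j]
  simp [Matrix.mul_apply, dotProduct]

theorem of_mul_mul_transpose_apply (u : Fin d → Fin d → ℝ) (L : Matrix (Fin d) (Fin d) ℝ)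
    (i j : Fin d) : (Matrix.of u * L * (Matrix.of u)ᵀ) i j = u i ⬝ᵥ L *ᵥ u j := by
  rw [Matrix.mul_assoc]
  simp only [Matrix.mul_apply, dotProduct, mulVec, of_apply, transpose_apply]

theorem trace_mul_eq_sum {u : Fin d → Fin d → ℝ}
    (hu : ∀ i j, u i ⬝ᵥ u j = if i = j then 1 else 0) (A B : Matrix (Fin d) (Fin d) ℝ) :
    (A * B).trace = ∑ i, ∑ j, (u i ⬝ᵥ A *ᵥ u j) * (u j ⬝ᵥ B *ᵥ u i) := by
  have h1 := of_mul_transpose hu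
  have h2 : (Matrix.of u)ᵀ * Matrix.of u = 1 := mul_eq_one_comm.1 h1
  have h3 : (A * B).trace =
      ((Matrix.of u * A * (Matrix.of u)ᵀ) * (Matrix.of u * B * (Matrix.of u)ᵀ)).trace := by
    have h4 := conj_mul_conj (Q := (Matrix.of u)ᵀ) h2 A B
    have h5 := trace_conj (Q := (Matrix.of u)ᵀ) h2 (A * B)
    rw [transpose_transpose] at h4 h5
    rw [h4, h5]
  rw [h3, Matrix.trace]
  simp only [diag_apply, Matrix.mul_apply (M := _ * A * _), of_mul_mul_transpose_apply]

theorem trace_eq_sum {u : Fin d → Fin d → ℝ}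
    (hu : ∀ i j, u i ⬝ᵥ u j = if i = j then 1 else 0) (A : Matrix (Fin d) (Fin d) ℝ) :
    A.trace = ∑ i, u i ⬝ᵥ A *ᵥ u i := by
  have h1 := of_mul_transpose hu
  have h2 : (Matrix.of u)ᵀ * Matrix.of u = 1 := mul_eq_one_comm.1 h1
  rw [← trace_conj (Q := (Matrix.of u)ᵀ) h2 A, Matrix.trace]
  simp only [diag_apply, transpose_transpose, of_mul_mul_transpose_apply]

theorem dotProduct_mulVec_comm {L : Matrix (Fin d) (Fin d) ℝ} (hL : L.IsSymm) (x y : Fin d → ℝ) :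
    x ⬝ᵥ L *ᵥ y = y ⬝ᵥ L *ᵥ x := by
  rw [dotProduct_mulVec, ← mulVec_transpose, hL.eq, dotProduct_comm]

theorem frobNorm_sq_eq_sum {u : Fin d → Fin d → ℝ}
    (hu : ∀ i j, u i ⬝ᵥ u j = if i = j then 1 else 0) {L : Matrix (Fin d) (Fin d) ℝ}
    (hL : L.IsSymm) : frobNorm L ^ 2 = ∑ i, ∑ j, (u i ⬝ᵥ L *ᵥ u j) ^ 2 := by
  rw [frobNorm_sq, ← frobInner_self, frobInner, hL.eq, trace_mul_eq_sum hu]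
  exact Finset.sum_congr rfl fun i _ => Finset.sum_congr rfl fun j _ => by
    rw [dotProduct_mulVec_comm hL (u j), sq]

/-! ### Density matrices in their eigenbasis. -/

namespace IsEigendecomposition

variable {W : Matrix (Fin d) (Fin d) ℝ} {μ : Fin d → ℝ} {u : Fin d → Fin d → ℝ}

theorem mulVec (h : IsEigendecomposition W μ u) (i : Fin d) : W *ᵥ u i = μ i • u i := by
  rw [h.2, Matrix.sum_mulVec]
  simp only [smul_mulVec, outer, vecMulVec_mulVec, h.1]
  rw [Finset.sum_eq_single i] <;> simp +contextual [eq_comm]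

theorem dotProduct_mulVec (h : IsEigendecomposition W μ u) (i j : Fin d) :
    u i ⬝ᵥ W *ᵥ u j = if i = j then μ i else 0 := by
  rw [h.mulVec, dotProduct_smul, h.1]
  split_ifs with hij <;> simp [hij]

theorem pos (h : IsEigendecomposition W μ u) (hW : W.PosDef) (i : Fin d) : 0 < μ i := by
  have h1 := h.2
  rw [sum_outer_eq_conj] at h1
  rw [h1] at hW
  exact pos_of_posDef_conj_diagonal (of_mul_transpose h.1) hW i

theorem sum_eq_trace (h : IsEigendecomposition W μ u) : ∑ i, μ i = W.trace := by
  rw [trace_eq_sum h.1]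
  simp [h.dotProduct_mulVec]

theorem inv_eq (h : IsEigendecomposition W μ u) (hμ : ∀ i, 0 < μ i) :
    W⁻¹ = ∑ i, (μ i)⁻¹ • outer (u i) := by
  refine Matrix.inv_eq_right_inv ?_
  have h1 := of_mul_transpose h.1
  have h2 : (Matrix.of u)ᵀ * Matrix.of u = 1 := mul_eq_one_comm.1 h1
  rw [h.2, sum_outer_eq_conj, sum_outer_eq_conj, conj_mul_conj h1, diagonal_mul_diagonal]
  simp only [mul_inv_cancel₀ (hμ _).ne', diagonal_one, Matrix.mul_one, h2]

theorem dotProduct_inv_mulVec (h : IsEigendecomposition W μ u) (hμ : ∀ i, 0 < μ i)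
    (x : Fin d → ℝ) : x ⬝ᵥ W⁻¹ *ᵥ x = ∑ i, (μ i)⁻¹ * (u i ⬝ᵥ x) ^ 2 := by
  rw [h.inv_eq hμ, Matrix.sum_mulVec, dotProduct_sum]
  refine Finset.sum_congr rfl fun i _ => ?_
  rw [smul_mulVec, dotProduct_smul, outer, dotProduct_vecMulVec_mulVec, dotProduct_comm x, sq,
    smul_eq_mul]

theorem trace_mul (h : IsEigendecomposition W μ u) (A : Matrix (Fin d) (Fin d) ℝ) :
    (W * A).trace = ∑ i, μ i * (u i ⬝ᵥ A *ᵥ u i) := by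
  rw [trace_mul_eq_sum h.1]
  simp [h.dotProduct_mulVec]

end IsEigendecomposition

/-- The loss observed when the indices `i`, `j` and the sign `b` are drawn. -/
noncomputable def sparseLoss (u : Fin d → Fin d → ℝ) (L : Matrix (Fin d) (Fin d) ℝ) (i j : Fin d) (b : Bool) :
    ℝ :=
  frobInner (outer (sparseVector u i j b)) L

/-! ### Sparse sampling: unbiasedness, tameness and variance. -/

section Sampling

variable {u : Fin d → Fin d → ℝ} {L : Matrix (Fin d) (Fin d) ℝ}

theorem signVal_mul_self (b : Bool) : signVal b * signVal b = 1 := by cases b <;> simp [signVal]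

theorem sparseVector_dotProduct_self (hu : ∀ i j, u i ⬝ᵥ u j = if i = j then 1 else 0)
    (i j : Fin d) (b : Bool) : sparseVector u i j b ⬝ᵥ sparseVector u i j b = 1 := by
  unfold sparseVector
  split_ifs with hij
  · simp [hu]
  · have hs := signVal_mul_self b
    have h2 : (√2)⁻¹ * (√2)⁻¹ = 1 / 2 := by
      rw [← mul_inv, Real.mul_self_sqrt (by norm_num)]; norm_num
    simp only [one_div, smul_dotProduct, dotProduct_smul, add_dotProduct, dotProduct_add, hu,
      smul_eq_mul, hij, Ne.symm hij, if_false, if_true, mul_zero, add_zero, zero_add, mul_one]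
    linear_combination h2 * (1 + signVal b * signVal b) + (1 / 2) * hs

theorem sparseLoss_self (i : Fin d) (b : Bool) : sparseLoss u L i i b = u i ⬝ᵥ L *ᵥ u i := by
  rw [sparseLoss, frobInner_outer, sparseVector, if_pos rfl]

theorem sparseLoss_of_ne (hL : L.IsSymm) {i j : Fin d} (hij : i ≠ j) (b : Bool) :
    sparseLoss u L i j b =
      (u i ⬝ᵥ L *ᵥ u i + u j ⬝ᵥ L *ᵥ u j) / 2 + signVal b * (u i ⬝ᵥ L *ᵥ u j) := by
  rw [sparseLoss, frobInner_outer, sparseVector, if_neg hij]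
  have hs := signVal_mul_self b
  have h2 : (√2)⁻¹ * (√2)⁻¹ = 1 / 2 := by
    rw [← mul_inv, Real.mul_self_sqrt (by norm_num)]; norm_num
  simp only [one_div, smul_dotProduct, dotProduct_smul, add_dotProduct, dotProduct_add,
    mulVec_smul, mulVec_add, smul_eq_mul, dotProduct_mulVec_comm hL (u j) (u i)]
  linear_combination h2 * ((u i ⬝ᵥ L *ᵥ u i) + 2 * signVal b * (u i ⬝ᵥ L *ᵥ u j) +
    signVal b * signVal b * (u j ⬝ᵥ L *ᵥ u j)) + (1 / 2) * (u j ⬝ᵥ L *ᵥ u j) * hs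

theorem abs_sparseLoss_le (hu : ∀ i j, u i ⬝ᵥ u j = if i = j then 1 else 0)
    (hL : specNorm L ≤ 1) (i j : Fin d) (b : Bool) : |sparseLoss u L i j b| ≤ 1 := by
  rw [sparseLoss, frobInner_outer]
  have h := sparseVector_dotProduct_self hu i j b
  exact (abs_dotProduct_mulVec_le_specNorm L h h).trans hL

theorem sparseEstimate_isHermitian (lam : Fin d → ℝ) (i j : Fin d) (b : Bool) (l : ℝ) :
    (sparseEstimate lam u i j b l).IsHermitian := by
  unfold sparseEstimate
  rw [Matrix.IsHermitian, conjTranspose_eq_transpose_of_trivial]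
  split_ifs
  · simp [outer, transpose_vecMulVec]
  · simp [transpose_vecMulVec, add_comm]

theorem trace_mul_sparseEstimate_self (V : Matrix (Fin d) (Fin d) ℝ) (lam : Fin d → ℝ)
    (i : Fin d) (b : Bool) (l : ℝ) :
    (V * sparseEstimate lam u i i b l).trace = l / lam i ^ 2 * (u i ⬝ᵥ V *ᵥ u i) := by
  rw [sparseEstimate, if_pos rfl, Matrix.mul_smul, trace_smul, outer, trace_mul_vecMulVec,
    smul_eq_mul]

theorem trace_mul_sparseEstimate_of_ne (V : Matrix (Fin d) (Fin d) ℝ) (lam : Fin d → ℝ)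
    {i j : Fin d} (hij : i ≠ j) (b : Bool) (l : ℝ) :
    (V * sparseEstimate lam u i j b l).trace =
      signVal b * l / (2 * lam i * lam j) * (u i ⬝ᵥ V *ᵥ u j + u j ⬝ᵥ V *ᵥ u i) := by
  rw [sparseEstimate, if_neg hij, Matrix.mul_smul, trace_smul, Matrix.mul_add, trace_add,
    trace_mul_vecMulVec, trace_mul_vecMulVec, smul_eq_mul, add_comm (u j ⬝ᵥ _)]

/-- The sparse sampling estimate of the loss matrix is unbiased. -/
theorem sum_trace_mul_sparseEstimate (hu : ∀ i j, u i ⬝ᵥ u j = if i = j then 1 else 0)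
    (hL : L.IsSymm) (V : Matrix (Fin d) (Fin d) ℝ) {lam : Fin d → ℝ} (hlam : ∀ i, 0 < lam i) :
    ∑ i, ∑ j, ∑ b, lam i * lam j * (1 / 2) *
      (V * sparseEstimate lam u i j b (sparseLoss u L i j b)).trace = (V * L).trace := by
  -- For `i ≠ j`, the sign in the estimate cancels the diagonal part of the loss on average and
  -- squares to one against the cross term, isolating `⟨u i, L u j⟩`.
  have key : ∀ i j, ∑ b, lam i * lam j * (1 / 2) *
      (V * sparseEstimate lam u i j b (sparseLoss u L i j b)).trace =
      (1 / 2) * ((u i ⬝ᵥ V *ᵥ u j) * (u j ⬝ᵥ L *ᵥ u i)) +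
        (1 / 2) * ((u j ⬝ᵥ V *ᵥ u i) * (u i ⬝ᵥ L *ᵥ u j)) := fun i j => by
    have hi := (hlam i).ne'
    have hj := (hlam j).ne'
    rcases eq_or_ne i j with rfl | hij
    · simp only [trace_mul_sparseEstimate_self, sparseLoss_self, Fintype.sum_bool]
      field_simp
    · simp only [trace_mul_sparseEstimate_of_ne V lam hij, sparseLoss_of_ne hL hij,
        Fintype.sum_bool, signVal, dotProduct_mulVec_comm hL (u j) (u i)]
      field_simp; simp; ring
  simp only [key, Finset.sum_add_distrib, ← Finset.mul_sum]
  rw [Finset.sum_comm (f := fun i j => (u j ⬝ᵥ V *ᵥ u i) * (u i ⬝ᵥ L *ᵥ u j)),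
    ← trace_mul_eq_sum hu]
  ring

/-- The cross term averages out over the sign, so playing a pair costs in expectation the same as
playing one eigenvector drawn from `lam`. -/
theorem sum_sparseLoss (hL : L.IsSymm) {lam : Fin d → ℝ} (hlam : ∑ i, lam i = 1) :
    ∑ i, ∑ j, ∑ b, lam i * lam j * (1 / 2) * sparseLoss u L i j b =
      ∑ i, lam i * (u i ⬝ᵥ L *ᵥ u i) := by
  have key : ∀ i j, ∑ b, lam i * lam j * (1 / 2) * sparseLoss u L i j b =
      (1 / 2) * (lam j * (lam i * (u i ⬝ᵥ L *ᵥ u i))) +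
        (1 / 2) * (lam i * (lam j * (u j ⬝ᵥ L *ᵥ u j))) := fun i j => by
    rcases eq_or_ne i j with rfl | hij
    · simp only [sparseLoss_self, Fintype.sum_bool]; ring
    · simp only [sparseLoss_of_ne hL hij, Fintype.sum_bool, signVal]
      simp; ring
  simp only [key, Finset.sum_add_distrib, ← Finset.mul_sum, ← Finset.sum_mul, hlam]
  ring

/-- The quadratic term in the stability of mirror descent. -/
noncomputable def stability (W Lt : Matrix (Fin d) (Fin d) ℝ) (η : ℝ) : ℝ :=
  (W * (η • Lt) * (W * (η • Lt))).trace

variable {W : Matrix (Fin d) (Fin d) ℝ} {μ lam : Fin d → ℝ} {η : ℝ}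

theorem stability_sparseEstimate_self (h : IsEigendecomposition W μ u) (i : Fin d) (b : Bool)
    (l : ℝ) : stability W (sparseEstimate lam u i i b l) η =
      (η * l / lam i ^ 2) ^ 2 * μ i ^ 2 := by
  rw [stability, sparseEstimate, if_pos rfl, smul_smul, Matrix.mul_smul, outer, mul_vecMulVec,
    h.mulVec, smul_vecMulVec, Matrix.smul_mul, Matrix.smul_mul, Matrix.mul_smul, Matrix.mul_smul,
    mul_vecMulVec, vecMulVec_mulVec, h.1, if_pos rfl]
  simp [trace_vecMulVec, h.1]
  ring

theorem stability_sparseEstimate_of_ne (h : IsEigendecomposition W μ u) {i j : Fin d}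
    (hij : i ≠ j) (b : Bool) (l : ℝ) : stability W (sparseEstimate lam u i j b l) η =
      2 * ((η * l / (2 * lam i * lam j)) ^ 2 * (μ i * μ j)) := by
  have hs := signVal_mul_self b
  have key : W * (vecMulVec (u i) (u j) + vecMulVec (u j) (u i)) =
      μ i • vecMulVec (u i) (u j) + μ j • vecMulVec (u j) (u i) := by
    rw [Matrix.mul_add, mul_vecMulVec, mul_vecMulVec, h.mulVec, h.mulVec, smul_vecMulVec,
      smul_vecMulVec]
  rw [stability, sparseEstimate, if_neg hij, smul_smul, Matrix.mul_smul, key]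
  simp only [Matrix.smul_mul, Matrix.mul_smul, Matrix.add_mul, Matrix.mul_add, trace_smul,
    trace_add, trace_vecMulVec_mul, dotProduct_vecMulVec_mulVec, h.1, hij, hij.symm, if_false,
    if_true, smul_eq_mul]
  linear_combination (2 * ((η * l / (2 * lam i * lam j)) ^ 2 * (μ i * μ j))) * hs

/-- Multiplying the two hypotheses gives `4 η² m n ≤ a² b²`. The resulting `1 / 4` is the square of
the `1 / 2` allowed in the second-order expansion. -/
theorem sq_mul_le_quarter (hη : 0 < η) {m n a b l : ℝ} (hm : 0 < m) (hn : 0 < n) (ha : 0 < a)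
    (hb : 0 < b) (hma : 2 * η * m ≤ a ^ 2) (hnb : 2 * η * n ≤ b ^ 2) (hl : |l| ≤ 1) :
    (η * l / (a * b)) ^ 2 * (m * n) ≤ 1 / 4 := by
  have hl2 : l ^ 2 ≤ 1 := (sq_le_one_iff_abs_le_one l).2 hl
  have h1 : (2 * η * m) * (2 * η * n) ≤ a ^ 2 * b ^ 2 := by gcongr
  rw [div_pow, div_mul_eq_mul_div, div_le_iff₀ (by positivity)]
  have h3 : l ^ 2 * ((2 * η * m) * (2 * η * n)) ≤ 1 * ((2 * η * m) * (2 * η * n)) := by gcongr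
  nlinarith

/-- The conditions on the mixed eigenvalues that make the estimates tame. -/
structure IsTame (η : ℝ) (μ lam : Fin d → ℝ) : Prop where
  rate_pos : 0 < η
  eigenvalue_pos : ∀ i, 0 < μ i
  rate_le : ∀ i, η ≤ lam i
  le_two_mul : ∀ i, μ i ≤ 2 * lam i
  le_sq : ∀ i, 2 * η * μ i ≤ lam i ^ 2

theorem IsTame.pos (h : IsTame η μ lam) (i : Fin d) : 0 < lam i := h.rate_pos.trans_le (h.rate_le i)

theorem stability_nonneg_and_le_one (h : IsEigendecomposition W μ u) (ht : IsTame η μ lam)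
    (i j : Fin d) (b : Bool) {l : ℝ} (hl : |l| ≤ 1) :
    0 ≤ stability W (sparseEstimate lam u i j b l) η ∧
      stability W (sparseEstimate lam u i j b l) η ≤ 1 := by
  have hi := ht.eigenvalue_pos i
  have hj := ht.eigenvalue_pos j
  rcases eq_or_ne i j with rfl | hij
  · rw [stability_sparseEstimate_self h]
    refine ⟨by positivity, ?_⟩
    have := sq_mul_le_quarter ht.rate_pos hi hi (ht.pos i) (ht.pos i) (ht.le_sq i) (ht.le_sq i) hl
    rw [← sq, ← sq] at this
    linarith
  · rw [stability_sparseEstimate_of_ne h hij]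
    refine ⟨by positivity, ?_⟩
    have := sq_mul_le_quarter ht.rate_pos hi hj (ht.pos i) (ht.pos j) (ht.le_sq i) (ht.le_sq j) hl
    have h2 : (η * l / (2 * lam i * lam j)) ^ 2 * (μ i * μ j) =
        (1 / 4) * ((η * l / (lam i * lam j)) ^ 2 * (μ i * μ j)) := by
      rw [mul_assoc 2, div_pow, div_pow, mul_pow 2]; ring
    rw [h2]; linarith

/-- The estimate acts only on the span of the drawn eigenvectors, so nonnegativity has to be checked
on a form in one or two variables; the remaining eigendirections contribute nonnegative terms. -/
theorem posSemidef_half_inv_add_sparseEstimate (h : IsEigendecomposition W μ u)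
    (hW : W.IsHermitian) (ht : IsTame η μ lam) (i j : Fin d) (b : Bool) {l : ℝ} (hl : |l| ≤ 1) :
    ((1 / 2 : ℝ) • W⁻¹ + η • sparseEstimate lam u i j b l).PosSemidef := by
  have hsm : ∀ (c : ℝ) {A : Matrix (Fin d) (Fin d) ℝ}, A.IsHermitian → (c • A).IsHermitian :=
    fun c A hA => by
      rw [Matrix.IsHermitian, conjTranspose_smul, hA.eq]; simp
  have hi := ht.eigenvalue_pos i
  have hj := ht.eigenvalue_pos j
  refine PosSemidef.of_dotProduct_mulVec_nonneg
    ((hsm _ hW.inv).add (hsm _ (sparseEstimate_isHermitian _ _ _ _ _))) fun x => ?_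
  rw [star_trivial, add_mulVec, dotProduct_add, smul_mulVec, dotProduct_smul,
    h.dotProduct_inv_mulVec ht.eigenvalue_pos, smul_mulVec, dotProduct_smul, smul_eq_mul,
    smul_eq_mul]
  have hq := sq_mul_le_quarter ht.rate_pos hi hj (ht.pos i) (ht.pos j) (ht.le_sq i) (ht.le_sq j) hl
  have hnn : ∀ k, 0 ≤ (μ k)⁻¹ * (u k ⬝ᵥ x) ^ 2 := fun k => by
    have := ht.eigenvalue_pos k
    positivity
  rcases eq_or_ne i j with rfl | hij
  · have h1 := Finset.single_le_sum (fun k _ => hnn k) (Finset.mem_univ i)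
    rw [sparseEstimate, if_pos rfl, smul_mulVec, dotProduct_smul, outer,
      dotProduct_vecMulVec_mulVec, dotProduct_comm x, smul_eq_mul]
    rw [← sq, ← sq, ← mul_pow] at hq
    have h2 : |η * l / lam i ^ 2 * μ i| ≤ 1 / 2 :=
      abs_le_of_sq_le_sq (by linarith) (by norm_num)
    have h3 := (abs_le.1 h2).1
    have h4 : η * l / lam i ^ 2 ≥ -(1 / 2) * (μ i)⁻¹ := by
      rw [ge_iff_le, ← div_eq_mul_inv, div_le_iff₀ hi]; exact h3
    have h5 : 0 ≤ (u i ⬝ᵥ x) ^ 2 := sq_nonneg _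
    have h6 : η * (l / lam i ^ 2 * ((u i ⬝ᵥ x) * (u i ⬝ᵥ x))) =
        η * l / lam i ^ 2 * (u i ⬝ᵥ x) ^ 2 := by ring
    rw [h6]
    nlinarith
  · have h1 : (μ i)⁻¹ * (u i ⬝ᵥ x) ^ 2 + (μ j)⁻¹ * (u j ⬝ᵥ x) ^ 2 ≤
        ∑ k, (μ k)⁻¹ * (u k ⬝ᵥ x) ^ 2 := by
      rw [← Finset.sum_pair (f := fun k => (μ k)⁻¹ * (u k ⬝ᵥ x) ^ 2) hij]
      exact Finset.sum_le_sum_of_subset_of_nonneg (Finset.subset_univ _) fun k _ _ => hnn k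
    rw [sparseEstimate, if_neg hij, smul_mulVec, dotProduct_smul, add_mulVec, dotProduct_add,
      dotProduct_vecMulVec_mulVec, dotProduct_vecMulVec_mulVec, dotProduct_comm x,
      dotProduct_comm x, smul_eq_mul]
    set y := u i ⬝ᵥ x
    set z := u j ⬝ᵥ x
    set c := η * (signVal b * l / (2 * lam i * lam j)) with hc
    have hc2 : c ^ 2 * (μ i * μ j) ≤ 1 / 4 := by
      have : c ^ 2 = (1 / 4) * (η * l / (lam i * lam j)) ^ 2 := by
        have hs := signVal_mul_self b
        have : c = signVal b * ((1 / 2) * (η * l / (lam i * lam j))) := by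
          rw [hc, mul_assoc 2, mul_comm 2, ← div_div]; ring
        rw [this]; linear_combination ((1 / 2) * (η * l / (lam i * lam j))) ^ 2 * hs
      rw [this]
      have : 0 ≤ (η * l / (lam i * lam j)) ^ 2 * (μ i * μ j) := by positivity
      linarith
    -- This is the discriminant condition for the form `μ i⁻¹ y² + μ j⁻¹ z² + 4 c y z`; completing
    -- the square then gives `h5`.
    have h4 : 4 * c ^ 2 ≤ (μ i)⁻¹ * (μ j)⁻¹ := by
      rw [← mul_inv, ← one_div, le_div_iff₀ (by positivity)]
      linarith
    have hA : 0 < (μ i)⁻¹ := inv_pos.2 hi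
    have h5 : 0 ≤ (μ i)⁻¹ * y ^ 2 + (μ j)⁻¹ * z ^ 2 + 4 * c * y * z := by
      refine nonneg_of_mul_nonneg_right ?_ hA
      have h6 : 0 ≤ ((μ i)⁻¹ * (μ j)⁻¹ - 4 * c ^ 2) * z ^ 2 :=
        mul_nonneg (by linarith) (sq_nonneg z)
      nlinarith [sq_nonneg ((μ i)⁻¹ * y + 2 * c * z)]
    have h7 : η * (signVal b * l / (2 * lam i * lam j) * (y * z + z * y)) = 2 * c * y * z := by
      rw [hc]; ring
    rw [h7]
    linarith

/-- The probability `λ i λ j` cancels one factor of the squared denominator, leaving `(μ i / λ i) (μ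
j / λ j) ≤ 4` times a squared loss. Each diagonal entry of `L` is then counted for every partner
index, which is the source of the factor `d`. -/
theorem sum_stability_le (h : IsEigendecomposition W μ u) (hL : L.IsSymm) (ht : IsTame η μ lam)
    (hd : 1 ≤ d) :
    ∑ i, ∑ j, ∑ b, lam i * lam j * (1 / 2) *
      stability W (sparseEstimate lam u i j b (sparseLoss u L i j b)) η ≤
      4 * d * η ^ 2 * frobNorm L ^ 2 := by
  have hratio : ∀ i, 0 ≤ μ i / lam i ∧ μ i / lam i ≤ 2 := fun i =>
    ⟨div_nonneg (ht.eigenvalue_pos i).le (ht.pos i).le,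
      (div_le_iff₀ (ht.pos i)).2 (ht.le_two_mul i)⟩
  have key : ∀ i j, ∑ b, lam i * lam j * (1 / 2) *
      stability W (sparseEstimate lam u i j b (sparseLoss u L i j b)) η ≤
      η ^ 2 * (u i ⬝ᵥ L *ᵥ u i) ^ 2 + η ^ 2 * (u j ⬝ᵥ L *ᵥ u j) ^ 2 +
        2 * η ^ 2 * (u i ⬝ᵥ L *ᵥ u j) ^ 2 := fun i j => by
    have hi := (ht.pos i).ne'
    have hj := (ht.pos j).ne'
    rcases eq_or_ne i j with rfl | hij
    · simp only [stability_sparseEstimate_self h, sparseLoss_self, Fintype.sum_bool]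
      set m := u i ⬝ᵥ L *ᵥ u i
      have h1 : lam i * lam i * (1 / 2) * ((η * m / lam i ^ 2) ^ 2 * μ i ^ 2) +
          lam i * lam i * (1 / 2) * ((η * m / lam i ^ 2) ^ 2 * μ i ^ 2) =
          η ^ 2 * m ^ 2 * (μ i / lam i) ^ 2 := by
        field_simp; ring
      have h2 : (μ i / lam i) ^ 2 ≤ 2 ^ 2 := pow_le_pow_left₀ (hratio i).1 (hratio i).2 2
      rw [h1]
      have h3 : 0 ≤ η ^ 2 * m ^ 2 := by positivity
      nlinarith
    · simp only [stability_sparseEstimate_of_ne h hij, sparseLoss_of_ne hL hij, Fintype.sum_bool,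
        signVal]
      set m := u i ⬝ᵥ L *ᵥ u i
      set n := u j ⬝ᵥ L *ᵥ u j
      set k := u i ⬝ᵥ L *ᵥ u j
      have h1 : ∀ s : ℝ, lam i * lam j * (1 / 2) *
          (2 * ((η * ((m + n) / 2 + s * k) / (2 * lam i * lam j)) ^ 2 * (μ i * μ j))) =
          η ^ 2 * ((m + n) / 2 + s * k) ^ 2 * ((μ i / lam i) * (μ j / lam j)) * (1 / 4) :=
        fun s => by
          field_simp; ring
      rw [h1, h1]
      have h2 : (μ i / lam i) * (μ j / lam j) ≤ 2 * 2 :=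
        mul_le_mul (hratio i).2 (hratio j).2 (hratio j).1 (by norm_num)
      have h3 : ∀ s : ℝ,
          η ^ 2 * ((m + n) / 2 + s * k) ^ 2 * ((μ i / lam i) * (μ j / lam j)) * (1 / 4) ≤
          η ^ 2 * ((m + n) / 2 + s * k) ^ 2 := fun s => by
        have : 0 ≤ η ^ 2 * ((m + n) / 2 + s * k) ^ 2 := by positivity
        nlinarith
      refine (add_le_add (h3 _) (h3 _)).trans ?_
      simp only [if_true, Bool.false_eq_true, if_false]
      -- Summing over the two signs gives `(m + n)² / 2 + 2 k²`, and `(m + n)² / 2 ≤ m² + n²`.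
      have : 0 ≤ η ^ 2 * (m - n) ^ 2 := by positivity
      nlinarith
  refine (Finset.sum_le_sum fun i _ => Finset.sum_le_sum fun j _ => key i j).trans ?_
  have hd' : (1 : ℝ) ≤ d := by exact_mod_cast hd
  have hdiag : ∑ i, (u i ⬝ᵥ L *ᵥ u i) ^ 2 ≤ frobNorm L ^ 2 := by
    rw [frobNorm_sq_eq_sum h.1 hL]
    exact Finset.sum_le_sum fun i _ => Finset.single_le_sum
      (f := fun j => (u i ⬝ᵥ L *ᵥ u j) ^ 2) (fun j _ => sq_nonneg _) (Finset.mem_univ i)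
  simp only [Finset.sum_add_distrib, ← Finset.mul_sum, Finset.sum_const, Finset.card_univ,
    Fintype.card_fin, nsmul_eq_mul]
  rw [← frobNorm_sq_eq_sum h.1 hL]
  have h1 : 0 ≤ η ^ 2 * frobNorm L ^ 2 := by positivity
  have h2 : η ^ 2 * ∑ i, (u i ⬝ᵥ L *ᵥ u i) ^ 2 ≤ η ^ 2 * frobNorm L ^ 2 := by gcongr
  nlinarith

end Sampling

/-- The unit-trace comparator `(1 - 1 / T) v vᵀ + (1 / T) I / d`. -/
noncomputable def comparator (T : ℕ) (v : Fin d → ℝ) : Matrix (Fin d) (Fin d) ℝ :=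
  (1 - 1 / (T : ℝ)) • outer v + (1 / ((T : ℝ) * d)) • 1

/-! ### The smoothed comparator and the range of the potential. -/

section Comparator

variable {T : ℕ} {v : Fin d → ℝ}

theorem trace_comparator (hd : 1 ≤ d) (hT : 2 ≤ T) (hv : v ⬝ᵥ v = 1) :
    (comparator T v).trace = 1 := by
  have hd' : (d : ℝ) ≠ 0 := by positivity
  have hT' : (T : ℝ) ≠ 0 := by positivity
  simp [comparator, outer, trace_vecMulVec, hv]
  field_simp; ring

theorem comparator_sub_posSemidef (hT : 2 ≤ T) (v : Fin d → ℝ) :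
    (comparator T v - (1 / ((T : ℝ) * d)) • 1).PosSemidef := by
  have hT' : (2 : ℝ) ≤ T := by exact_mod_cast hT
  rw [comparator, add_sub_cancel_right]
  have h := posSemidef_vecMulVec_self_star v
  rw [star_trivial] at h
  refine h.smul ?_
  rw [sub_nonneg, div_le_one (by linarith)]; linarith

theorem comparator_posDef (hd : 1 ≤ d) (hT : 2 ≤ T) (v : Fin d → ℝ) :
    (comparator T v).PosDef := by
  have h1 : ((1 / ((T : ℝ) * d)) • (1 : Matrix (Fin d) (Fin d) ℝ)).PosDef :=
    PosDef.one.smul (by positivity)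
  have := h1.add_posSemidef (comparator_sub_posSemidef hT v)
  rwa [add_sub_cancel] at this

/-- The admixture of the identity keeps every eigenvalue at least `1 / (T d)`. -/
theorem log_det_comparator_ge (hd : 1 ≤ d) (hT : 2 ≤ T) (v : Fin d → ℝ) :
    -(d * Real.log (T * d)) ≤ Real.log (comparator T v).det := by
  have hP := comparator_posDef hd hT v
  have hS := comparator_sub_posSemidef hT v
  obtain ⟨a, Q, hQ, hQ', hA⟩ := exists_orthogonal_diagonalization hP.1
  rw [hA] at hS ⊢
  have ha := le_of_posSemidef_conj_diagonal_sub hQ hS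
  have hc : 0 < 1 / ((T : ℝ) * d) := by positivity
  rw [det_conj hQ, det_diagonal, Real.log_prod fun i _ => (hc.trans_le (ha i)).ne']
  calc -(d * Real.log (T * d)) = ∑ _i : Fin d, Real.log (1 / ((T : ℝ) * d)) := by
        rw [one_div, Real.log_inv]; simp
    _ ≤ _ := Finset.sum_le_sum fun i _ => Real.log_le_log hc (ha i)

end Comparator

theorem initial_posDef (hd : 1 ≤ d) : (initial d).PosDef :=
  PosDef.one.smul (by positivity)

theorem trace_initial (hd : 1 ≤ d) : (initial d).trace = 1 := by
  have hd' : (d : ℝ) ≠ 0 := by positivity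
  simp [initial, hd']

/-- The potential whose increments control the regret of mirror descent. -/
noncomputable def potential (U W : Matrix (Fin d) (Fin d) ℝ) : ℝ :=
  Real.log W.det + (U * W⁻¹).trace

theorem potential_initial (hd : 1 ≤ d) {U : Matrix (Fin d) (Fin d) ℝ} (hU : U.trace = 1) :
    potential U (initial d) = d - d * Real.log d := by
  have hd' : (d : ℝ) ≠ 0 := by positivity
  have hinv : (initial d)⁻¹ = (d : ℝ) • 1 := by
    refine Matrix.inv_eq_right_inv ?_
    rw [initial, Matrix.smul_mul, Matrix.mul_smul, Matrix.one_mul, smul_smul, one_div_mul_cancel hd',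
      one_smul]
  rw [potential, hinv, Matrix.mul_smul, Matrix.mul_one, trace_smul, hU, initial, det_smul]
  simp
  ring

/-- The Fenchel inequality for the pair `U`, `W⁻¹`; it bounds the potential from below after the
last round. -/
theorem log_det_add_le_potential {U W : Matrix (Fin d) (Fin d) ℝ} (hU : U.PosDef)
    (hW : W.PosDef) : Real.log U.det + d ≤ potential U W := by
  have h := log_det_add_log_det_le hU hW.inv
  rw [det_nonsing_inv, Ring.inverse_eq_inv', Real.log_inv] at h
  rw [potential]; linarith

/-! ### The run: invariants and the pathwise regret bound. -/

namespace SparseRun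

variable {Ω : Type*} [MeasurableSpace Ω] {P : Measure Ω} {T : ℕ} {η γ : ℝ}

/-- The sampling distribution of round `t`. -/
noncomputable def lam (X : SparseRun P d T η γ) (t : ℕ) (ω : Ω) : Fin d → ℝ := mixed γ (X.μ t ω)

/-- The loss estimate that is formed in round `t` if `i`, `j` and `b` are drawn. -/
noncomputable def estimate (X : SparseRun P d T η γ) (t : ℕ) (i j : Fin d) (b : Bool) (ω : Ω) :
    Matrix (Fin d) (Fin d) ℝ :=
  sparseEstimate (X.lam t ω) (X.u t ω) i j b (sparseLoss (X.u t ω) (X.L t ω) i j b)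

theorem isUpdate_succ (X : SparseRun P d T η γ) (hd : 1 ≤ d) {t : ℕ} (ht : t + 1 < T) (ω : Ω)
    (hW : (X.W t ω).IsHermitian) : IsUpdate η (X.W t ω)
      (X.estimate t (X.I t ω) (X.J t ω) (X.s t ω) ω) (X.W (t + 1) ω) := by
  rw [X.W_succ t ht ω]
  exact isUpdate_update hd hW (sparseEstimate_isHermitian _ _ _ _ _)

theorem posDef_and_trace (X : SparseRun P d T η γ) (hd : 1 ≤ d) (ω : Ω) (t : ℕ) :
    t < T → (X.W t ω).PosDef ∧ (X.W t ω).trace = 1 := by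
  induction t with
  | zero => exact fun _ => by rw [X.W_zero ω]; exact ⟨initial_posDef hd, trace_initial hd⟩
  | succ t ih =>
      intro ht
      have h := X.isUpdate_succ hd ht ω (ih (by omega)).1.1
      exact ⟨h.1, h.2.1⟩

theorem sum_eigenvalues (X : SparseRun P d T η γ) (hd : 1 ≤ d) {t : ℕ} (ht : t < T) (ω : Ω) :
    ∑ i, X.μ t ω i = 1 := by
  rw [(X.eigendecomposition t ht ω).sum_eq_trace, (X.posDef_and_trace hd ω t ht).2]

theorem sum_lam (X : SparseRun P d T η γ) (hd : 1 ≤ d) {t : ℕ} (ht : t < T) (ω : Ω) :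
    ∑ i, X.lam t ω i = 1 := by
  have hd' : (d : ℝ) ≠ 0 := by positivity
  simp only [lam, mixed, Finset.sum_add_distrib, ← Finset.mul_sum, X.sum_eigenvalues hd ht ω]
  simp [hd']

/-- Since `γ / d = η` and `γ ≤ 1 / 2`, one has `λ i ≥ μ i / 2 + η`; the quadratic condition is then
the arithmetic-geometric mean inequality. -/
theorem isTame (X : SparseRun P d T η (d * η)) (hd : 1 ≤ d) (hη : 0 < η) (hη' : d * η ≤ 1 / 2)
    {t : ℕ} (ht : t < T) (ω : Ω) : IsTame η (X.μ t ω) (X.lam t ω) := by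
  have hd' : (d : ℝ) ≠ 0 := by positivity
  have hμ := (X.eigendecomposition t ht ω).pos (X.posDef_and_trace hd ω t ht).1
  have hlam : ∀ i, X.μ t ω i / 2 + η ≤ X.lam t ω i := fun i => by
    have h : X.lam t ω i = (1 - d * η) * X.μ t ω i + η := by
      simp only [lam, mixed]; field_simp
    have := hμ i
    rw [h]; nlinarith
  refine ⟨hη, hμ, fun i => ?_, fun i => ?_, fun i => ?_⟩ <;> have h1 := hμ i <;> have h2 := hlam i
  · linarith
  · linarith
  · calc 2 * η * X.μ t ω i ≤ (X.μ t ω i / 2 + η) ^ 2 := by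
          nlinarith [sq_nonneg (X.μ t ω i / 2 - η)]
      _ ≤ _ := pow_le_pow_left₀ (by linarith) h2 2

/-- The steps telescope. The terms `d` and `d log d` in the initial potential cancel against those
in its final lower bound, leaving `d log T`. -/
theorem sum_trace_estimate_le (X : SparseRun P d T η (d * η)) (hd : 1 ≤ d) (hT : 2 ≤ T)
    (hη : 0 < η) (hη' : d * η ≤ 1 / 2) (ω : Ω) {v : Fin d → ℝ} (hv : v ⬝ᵥ v = 1) :
    η * ∑ t ∈ Finset.range T, ((X.W t ω - comparator T v) *
        X.estimate t (X.I t ω) (X.J t ω) (X.s t ω) ω).trace ≤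
      d * Real.log T + 2 * ∑ t ∈ Finset.range T,
        stability (X.W t ω) (X.estimate t (X.I t ω) (X.J t ω) (X.s t ω) ω) η := by
  set U := comparator T v
  have hUtr : U.trace = 1 := trace_comparator hd hT hv
  have key : ∀ n ≤ T, ∃ V : Matrix (Fin d) (Fin d) ℝ, V.PosDef ∧ (n < T → V = X.W n ω) ∧
      η * ∑ t ∈ Finset.range n, ((X.W t ω - U) *
        X.estimate t (X.I t ω) (X.J t ω) (X.s t ω) ω).trace ≤
      potential U (initial d) - potential U V + 2 * ∑ t ∈ Finset.range n,
        stability (X.W t ω) (X.estimate t (X.I t ω) (X.J t ω) (X.s t ω) ω) η := by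
    intro n
    induction n with
    | zero => exact fun _ => ⟨initial d, initial_posDef hd, fun _ => (X.W_zero ω).symm, by simp⟩
    | succ n ih =>
      intro hn
      obtain ⟨V, hV, hVW, hle⟩ := ih (by omega)
      obtain rfl := hVW (by omega)
      -- The run constrains `W` only in rounds before `T`, so after the last round an auxiliary
      -- update plays the part of the next density matrix.
      have hup : ∃ V', IsUpdate η (X.W n ω) (X.estimate n (X.I n ω) (X.J n ω) (X.s n ω) ω) V' ∧
          (n + 1 < T → V' = X.W (n + 1) ω) := by
        by_cases h : n + 1 < T
        · exact ⟨_, X.isUpdate_succ hd h ω hV.1, fun _ => rfl⟩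
        · exact ⟨_, isUpdate_update hd hV.1 (sparseEstimate_isHermitian _ _ _ _ _),
            fun h' => absurd h' h⟩
      obtain ⟨V', hV', hV'W⟩ := hup
      refine ⟨V', hV'.1, hV'W, ?_⟩
      have hdec := X.eigendecomposition n (by omega) ω
      have hl := abs_sparseLoss_le hdec.1 (X.loss_norm_le n (by omega) ω) (X.I n ω) (X.J n ω)
        (X.s n ω)
      have hstep := mirror_descent_step hV hUtr
        (posSemidef_half_inv_add_sparseEstimate hdec hV.1 (X.isTame hd hη hη' (by omega) ω) _ _ _ hl)
        hV'
      rw [Finset.sum_range_succ, Finset.sum_range_succ, mul_add, mul_add]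
      simp only [potential, stability, estimate] at *
      linarith
  obtain ⟨V, hV, -, hle⟩ := key T le_rfl
  have h1 := log_det_add_le_potential (comparator_posDef hd hT v) hV
  have h2 := log_det_comparator_ge hd hT v
  rw [potential_initial hd hUtr] at hle
  rw [Real.log_mul (by positivity) (by positivity)] at h2
  linarith

/-! ### Measurability and conditioning on the history. -/

section Measurability

theorem measurable_loss_coord (X : SparseRun P d T η γ) {t : ℕ} (ht : t < T) (i j : Fin d) :
    Measurable[X.ℱ t] fun ω => X.u t ω i ⬝ᵥ X.L t ω *ᵥ X.u t ω j := by
  simp only [dotProduct, mulVec]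
  refine Finset.measurable_fun_sum _ fun p _ => ?_
  refine (X.eigenvector_measurable t ht i p).mul (Finset.measurable_fun_sum _ fun q _ => ?_)
  exact (X.loss_measurable t ht p q).mul (X.eigenvector_measurable t ht j q)

theorem measurable_lam (X : SparseRun P d T η γ) {t : ℕ} (ht : t < T) (i : Fin d) :
    Measurable[X.ℱ t] fun ω => X.lam t ω i :=
  ((X.eigenvalue_measurable t ht i).const_mul (1 - γ)).add_const _

theorem measurable_sparseLoss (X : SparseRun P d T η γ) {t : ℕ} (ht : t < T) (i j : Fin d)
    (b : Bool) : Measurable[X.ℱ t] fun ω => sparseLoss (X.u t ω) (X.L t ω) i j b := by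
  rcases eq_or_ne i j with rfl | hij
  · simp only [sparseLoss_self]
    exact X.measurable_loss_coord ht i i
  · have : (fun ω => sparseLoss (X.u t ω) (X.L t ω) i j b) = fun ω =>
        (X.u t ω i ⬝ᵥ X.L t ω *ᵥ X.u t ω i + X.u t ω j ⬝ᵥ X.L t ω *ᵥ X.u t ω j) / 2 +
          signVal b * (X.u t ω i ⬝ᵥ X.L t ω *ᵥ X.u t ω j) :=
      funext fun ω => sparseLoss_of_ne (X.loss_symm t ht ω) hij b
    rw [this]
    exact (((X.measurable_loss_coord ht i i).add (X.measurable_loss_coord ht j j)).div_const 2).add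
      ((X.measurable_loss_coord ht i j).const_mul _)

/-- The run assumes measurability of eigenvalues and eigenvectors rather than of `W`; in its own
eigenbasis `W` is diagonal, so this is enough. -/
theorem measurable_coord_sub (X : SparseRun P d T η γ) {t : ℕ} (ht : t < T)
    (U : Matrix (Fin d) (Fin d) ℝ) (i j : Fin d) :
    Measurable[X.ℱ t] fun ω => X.u t ω i ⬝ᵥ (X.W t ω - U) *ᵥ X.u t ω j := by
  have : (fun ω => X.u t ω i ⬝ᵥ (X.W t ω - U) *ᵥ X.u t ω j) = fun ω =>
      (if i = j then X.μ t ω i else 0) - X.u t ω i ⬝ᵥ U *ᵥ X.u t ω j := funext fun ω => by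
    rw [sub_mulVec, dotProduct_sub, (X.eigendecomposition t ht ω).dotProduct_mulVec]
  rw [this]
  refine Measurable.sub ?_ ?_
  · split_ifs
    · exact X.eigenvalue_measurable t ht i
    · exact measurable_const
  · simp only [dotProduct, mulVec]
    refine Finset.measurable_fun_sum _ fun p _ => ?_
    refine (X.eigenvector_measurable t ht i p).mul (Finset.measurable_fun_sum _ fun q _ => ?_)
    exact (X.eigenvector_measurable t ht j q).const_mul _

theorem measurable_trace_estimate (X : SparseRun P d T η γ) {t : ℕ} (ht : t < T)
    (U : Matrix (Fin d) (Fin d) ℝ) (i j : Fin d) (b : Bool) :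
    Measurable[X.ℱ t] fun ω => ((X.W t ω - U) * X.estimate t i j b ω).trace := by
  rcases eq_or_ne i j with rfl | hij
  · simp only [estimate, trace_mul_sparseEstimate_self]
    exact ((X.measurable_sparseLoss ht i i b).div ((X.measurable_lam ht i).pow_const 2)).mul
      (X.measurable_coord_sub ht U i i)
  · simp only [estimate, trace_mul_sparseEstimate_of_ne _ _ hij]
    exact (((X.measurable_sparseLoss ht i j b).const_mul _).div
      (((X.measurable_lam ht i).const_mul 2).mul (X.measurable_lam ht j))).mul
      ((X.measurable_coord_sub ht U i j).add (X.measurable_coord_sub ht U j i))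

theorem measurable_stability (X : SparseRun P d T η γ) {t : ℕ} (ht : t < T) (i j : Fin d)
    (b : Bool) : Measurable[X.ℱ t] fun ω => stability (X.W t ω) (X.estimate t i j b ω) η := by
  rcases eq_or_ne i j with rfl | hij
  · have : (fun ω => stability (X.W t ω) (X.estimate t i i b ω) η) = fun ω =>
        (η * sparseLoss (X.u t ω) (X.L t ω) i i b / X.lam t ω i ^ 2) ^ 2 * X.μ t ω i ^ 2 :=
      funext fun ω => stability_sparseEstimate_self (X.eigendecomposition t ht ω) i b _
    rw [this]
    exact ((((X.measurable_sparseLoss ht i i b).const_mul _).div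
      ((X.measurable_lam ht i).pow_const 2)).pow_const 2).mul
      ((X.eigenvalue_measurable t ht i).pow_const 2)
  · have : (fun ω => stability (X.W t ω) (X.estimate t i j b ω) η) = fun ω =>
        2 * ((η * sparseLoss (X.u t ω) (X.L t ω) i j b / (2 * X.lam t ω i * X.lam t ω j)) ^ 2 *
          (X.μ t ω i * X.μ t ω j)) :=
      funext fun ω => stability_sparseEstimate_of_ne (X.eigendecomposition t ht ω) hij b _
    rw [this]
    exact (((((X.measurable_sparseLoss ht i j b).const_mul _).div
      (((X.measurable_lam ht i).const_mul 2).mul (X.measurable_lam ht j))).pow_const 2).mul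
      ((X.eigenvalue_measurable t ht i).mul (X.eigenvalue_measurable t ht j))).const_mul 2

theorem measurable_frobNorm (X : SparseRun P d T η γ) {t : ℕ} (ht : t < T) :
    Measurable[X.ℱ t] fun ω => frobNorm (X.L t ω) := by
  simp only [frobNorm, frobInner_self]
  refine Measurable.sqrt ?_
  exact Finset.measurable_fun_sum _ fun i _ => Finset.measurable_fun_sum _ fun j _ =>
    (X.loss_measurable t ht i j).pow_const 2

end Measurability

/-- This is the passage from the actual draw to its conditional law: each `G i j b` is known from
the history and pulls out of the conditional expectation of the draw's indicator. The uniform bound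
supplies integrability. -/
theorem integral_draw [IsProbabilityMeasure P] (X : SparseRun P d T η γ) {t : ℕ} (ht : t < T)
    {G : Fin d → Fin d → Bool → Ω → ℝ} (hG : ∀ i j b, Measurable[X.ℱ t] (G i j b)) {C : ℝ}
    (hC : ∀ i j b ω, |G i j b ω| ≤ C) :
    Integrable (fun ω => G (X.I t ω) (X.J t ω) (X.s t ω) ω) P ∧
    Integrable (fun ω => ∑ i, ∑ j, ∑ b, X.lam t ω i * X.lam t ω j * (1 / 2) * G i j b ω) P ∧
    ∫ ω, G (X.I t ω) (X.J t ω) (X.s t ω) ω ∂P =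
      ∫ ω, ∑ i, ∑ j, ∑ b, X.lam t ω i * X.lam t ω j * (1 / 2) * G i j b ω ∂P := by
  set A : Fin d → Fin d → Bool → Set Ω :=
    fun i j b => {ω | X.I t ω = i ∧ X.J t ω = j ∧ X.s t ω = b} with hA
  have hAm : ∀ i j b, MeasurableSet (A i j b) := fun i j b => by
    have h := (X.draw_measurable t ht).mono (X.ℱ.le (t + 1)) le_rfl
    have : A i j b = (fun ω => (X.I t ω, X.J t ω, X.s t ω)) ⁻¹' {(i, j, b)} := by
      ext ω; simp [hA]
    rw [this]
    exact h (measurableSet_singleton _)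
  set χ : Fin d → Fin d → Bool → Ω → ℝ := fun i j b => (A i j b).indicator fun _ => 1 with hχ
  have hχi : ∀ i j b, Integrable (χ i j b) P := fun i j b =>
    (integrable_const 1).indicator (hAm i j b)
  have hGi : ∀ i j b, Integrable (G i j b * χ i j b) P := fun i j b =>
    (hχi i j b).bdd_mul ((hG i j b).mono (X.ℱ.le t) le_rfl).aestronglyMeasurable
      (Filter.Eventually.of_forall fun ω => hC i j b ω)
  have hce : ∀ i j b, P[G i j b * χ i j b | X.ℱ t] =ᵐ[P]
      fun ω => X.lam t ω i * X.lam t ω j * (1 / 2) * G i j b ω := fun i j b => by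
    have h1 := condExp_mul_of_stronglyMeasurable_left (μ := P)
      ((hG i j b).stronglyMeasurable) (hGi i j b) (hχi i j b)
    filter_upwards [h1, X.draw_law t ht i j b] with ω h1 h2
    rw [h1, Pi.mul_apply, h2, mul_comm]; rfl
  have hri : ∀ i j b, Integrable
      (fun ω => X.lam t ω i * X.lam t ω j * (1 / 2) * G i j b ω) P := fun i j b =>
    integrable_condExp.congr (hce i j b)
  -- At each `ω` exactly one indicator is nonzero, that of the actual draw.
  have heq : (fun ω => G (X.I t ω) (X.J t ω) (X.s t ω) ω) =
      fun ω => ∑ i, ∑ j, ∑ b, (G i j b * χ i j b) ω := funext fun ω => by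
    rw [Finset.sum_eq_single (X.I t ω), Finset.sum_eq_single (X.J t ω),
      Finset.sum_eq_single (X.s t ω)]
    · simp [hχ, hA]
    · exact fun k _ hk => by simp [hχ, hA, hk.symm]
    · simp
    · exact fun k _ hk => by simp [hχ, hA, hk.symm]
    · simp
    · exact fun k _ hk => by simp [hχ, hA, hk.symm]
    · simp
  have hri' : Integrable
      (fun ω => ∑ i, ∑ j, ∑ b, X.lam t ω i * X.lam t ω j * (1 / 2) * G i j b ω) P :=
    integrable_finsetSum _ fun i _ => integrable_finsetSum _ fun j _ =>
      integrable_finsetSum _ fun b _ => hri i j b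
  refine ⟨?_, hri', ?_⟩
  · rw [heq]
    exact integrable_finsetSum _ fun i _ => integrable_finsetSum _ fun j _ =>
      integrable_finsetSum _ fun b _ => hGi i j b
  · rw [heq, integral_finsetSum _ fun i _ => integrable_finsetSum _ fun j _ =>
      integrable_finsetSum _ fun b _ => hGi i j b,
      integral_finsetSum _ fun i _ => integrable_finsetSum _ fun j _ =>
      integrable_finsetSum _ fun b _ => hri i j b]
    refine Finset.sum_congr rfl fun i _ => ?_
    rw [integral_finsetSum _ fun j _ => integrable_finsetSum _ fun b _ => hGi i j b,
      integral_finsetSum _ fun j _ => integrable_finsetSum _ fun b _ => hri i j b]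
    refine Finset.sum_congr rfl fun j _ => ?_
    rw [integral_finsetSum _ fun b _ => hGi i j b, integral_finsetSum _ fun b _ => hri i j b]
    refine Finset.sum_congr rfl fun b _ => ?_
    rw [← integral_condExp (X.ℱ.le t), integral_congr_ae (hce i j b)]

end SparseRun

/-! ### Frobenius norm versus spectral norm and rank. -/

theorem abs_apply_le_specNorm (L : Matrix (Fin d) (Fin d) ℝ) (i j : Fin d) :
    |L i j| ≤ specNorm L := by
  have h := abs_dotProduct_mulVec_le_specNorm L (x := Pi.single i 1) (y := Pi.single j 1)
    (by simp) (by simp)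
  simpa using h

theorem frobNorm_le_of_specNorm_le_one {L : Matrix (Fin d) (Fin d) ℝ} (hL : specNorm L ≤ 1) :
    frobNorm L ≤ d := by
  refine (sq_le_sq₀ (frobNorm_nonneg L) (by positivity)).1 ?_
  rw [frobNorm_sq]
  calc ∑ i, ∑ j, L i j ^ 2 ≤ ∑ _i : Fin d, ∑ _j : Fin d, (1 : ℝ) :=
        Finset.sum_le_sum fun i _ => Finset.sum_le_sum fun j _ =>
          (sq_le_one_iff_abs_le_one _).2 ((abs_apply_le_specNorm L i j).trans hL)
    _ = (d : ℝ) ^ 2 := by simp [sq]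

/-- The squared Frobenius norm is the sum of squared eigenvalues. At most one is nonzero, and the
spectral norm bounds it by one. -/
theorem frobNorm_sq_le_one_of_rank_le_one {L : Matrix (Fin d) (Fin d) ℝ} (hL : L.IsSymm)
    (hs : specNorm L ≤ 1) (hr : L.rank ≤ 1) : frobNorm L ^ 2 ≤ 1 := by
  obtain ⟨a, Q, hQ, hQ', hA⟩ := exists_orthogonal_diagonalization
    (A := L) (by rwa [Matrix.IsHermitian, conjTranspose_eq_transpose_of_trivial])
  have hdet : IsUnit Q.det := (Matrix.isUnit_iff_isUnit_det Q).1 (IsUnit.of_mul_eq_one _ hQ)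
  have hdet' : IsUnit Qᵀ.det := by rwa [det_transpose]
  have hrank : Fintype.card {i // a i ≠ 0} ≤ 1 := by
    rw [← rank_diagonal a, ← rank_mul_eq_right_of_isUnit_det Qᵀ (diagonal a) hdet',
      ← rank_mul_eq_left_of_isUnit_det Q _ hdet, ← hA]
    exact hr
  have hQu : ∀ i j, Q i ⬝ᵥ Q j = if i = j then 1 else 0 := fun i j => by
    rw [← Matrix.one_apply, ← hQ, Matrix.mul_apply]; rfl
  have ha : ∀ i, |a i| ≤ 1 := fun i => by
    have h1 : (Q * L * Qᵀ) i i = a i := by rw [hA, conj_conj_symm hQ]; simp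
    have h2 := of_mul_mul_transpose_apply Q L i i
    rw [show Matrix.of Q = Q from rfl, h1] at h2
    rw [h2]
    have h3 : Q i ⬝ᵥ Q i = 1 := by rw [hQu, if_pos rfl]
    exact (abs_dotProduct_mulVec_le_specNorm L h3 h3).trans hs
  have hsum : frobNorm L ^ 2 = ∑ i, a i ^ 2 := by
    rw [frobNorm_sq, ← frobInner_self, frobInner, hL.eq, hA, conj_mul_conj hQ, trace_conj hQ,
      diagonal_mul_diagonal, trace_diagonal]
    simp only [sq]
  rw [hsum]
  calc ∑ i, a i ^ 2 = ∑ i with a i ≠ 0, a i ^ 2 :=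
        (Finset.sum_filter_of_ne fun i _ h => by rintro h0; simp [h0] at h).symm
    _ ≤ ∑ i with a i ≠ 0, (1 : ℝ) :=
        Finset.sum_le_sum fun i _ => (sq_le_one_iff_abs_le_one _).2 (ha i)
    _ ≤ 1 := by
        rw [Finset.sum_const, nsmul_eq_mul, mul_one, ← Fintype.card_subtype]
        exact_mod_cast hrank

/-! ### Expected regret and tuning of the learning rate. -/

namespace SparseRun

variable {Ω : Type*} [MeasurableSpace Ω] {P : Measure Ω} {T : ℕ} {η γ : ℝ}

theorem frobInner_w_sub (X : SparseRun P d T η γ) (t : ℕ) (ω : Ω) (v : Fin d → ℝ) :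
    frobInner (outer (X.w t ω) - outer v) (X.L t ω) =
      sparseLoss (X.u t ω) (X.L t ω) (X.I t ω) (X.J t ω) (X.s t ω) - v ⬝ᵥ X.L t ω *ᵥ v := by
  rw [frobInner_sub_left, frobInner_outer v]; rfl

theorem frobInner_w_sub_le (X : SparseRun P d T η γ) {t : ℕ} (ht : t < T) (ω : Ω)
    {v : Fin d → ℝ} (hv : v ⬝ᵥ v = 1) :
    frobInner (outer (X.w t ω) - outer v) (X.L t ω) ≤ 2 * frobNorm (X.L t ω) := by
  rw [frobInner_sub_left, frobInner_outer, frobInner_outer]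
  have h1 := abs_le.1 (abs_dotProduct_mulVec_le_frobNorm (X.L t ω) (x := X.w t ω)
    (sparseVector_dotProduct_self (X.eigendecomposition t ht ω).1 _ _ _))
  have h2 := abs_le.1 (abs_dotProduct_mulVec_le_frobNorm (X.L t ω) hv)
  linarith [h1.2, h2.1]

/-- A crude bound, needed only for integrability; `1 / η²` comes from `η ≤ λ i`. -/
theorem abs_trace_estimate_le (X : SparseRun P d T η (d * η)) (hd : 1 ≤ d)
    (hη : 0 < η) (hη' : d * η ≤ 1 / 2) {t : ℕ} (ht : t < T) (ω : Ω)
    (U : Matrix (Fin d) (Fin d) ℝ) (i j : Fin d) (b : Bool) :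
    |((X.W t ω - U) * X.estimate t i j b ω).trace| ≤ (1 / η ^ 2) * (1 + specNorm U) := by
  have hdec := X.eigendecomposition t ht ω
  have htame := X.isTame hd hη hη' ht ω
  have hl := abs_sparseLoss_le hdec.1 (X.loss_norm_le t ht ω) i j b
  have hK : ∀ i j, |X.u t ω i ⬝ᵥ (X.W t ω - U) *ᵥ X.u t ω j| ≤ 1 + specNorm U := fun i j => by
    rw [sub_mulVec, dotProduct_sub]
    refine (abs_sub _ _).trans (add_le_add ?_ (abs_dotProduct_mulVec_le_specNorm U
      (by rw [hdec.1, if_pos rfl]) (by rw [hdec.1, if_pos rfl])))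
    rw [hdec.dotProduct_mulVec]
    split_ifs
    · rw [abs_of_pos (htame.eigenvalue_pos i), ← X.sum_eigenvalues hd ht ω]
      exact Finset.single_le_sum (fun k _ => (htame.eigenvalue_pos k).le) (Finset.mem_univ i)
    · simp
  have hc : |sparseLoss (X.u t ω) (X.L t ω) i j b / (X.lam t ω i * X.lam t ω j)| ≤ 1 / η ^ 2 := by
    have hi := htame.rate_le i
    have hj := htame.rate_le j
    have hi0 := htame.pos i
    have hj0 := htame.pos j
    rw [abs_div, abs_of_pos (mul_pos hi0 hj0), sq]
    gcongr
  have hmul : ∀ {x y : ℝ}, |x| ≤ 1 / η ^ 2 → |y| ≤ 1 + specNorm U →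
      |x * y| ≤ (1 / η ^ 2) * (1 + specNorm U) := fun hx hy => by
    rw [abs_mul]; gcongr
  rcases eq_or_ne i j with rfl | hij
  · rw [estimate, trace_mul_sparseEstimate_self, sq]
    exact hmul hc (hK i i)
  · rw [estimate, trace_mul_sparseEstimate_of_ne _ _ hij]
    have h1 : ∀ a c : ℝ, signVal b * sparseLoss (X.u t ω) (X.L t ω) i j b /
        (2 * X.lam t ω i * X.lam t ω j) * (a + c) =
        signVal b * (sparseLoss (X.u t ω) (X.L t ω) i j b / (X.lam t ω i * X.lam t ω j) *
          ((a + c) / 2)) := fun a c => by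
      rw [mul_assoc 2, mul_comm 2, ← div_div]; ring
    have hs : |signVal b| = 1 := by cases b <;> simp [signVal]
    rw [h1, abs_mul, hs, one_mul]
    refine hmul hc ?_
    have h2 := abs_le.1 (hK i j)
    have h3 := abs_le.1 (hK j i)
    rw [abs_le]
    constructor <;> linarith [h2.1, h2.2, h3.1, h3.2]

theorem sum_integral_sq_le (X : SparseRun P d T η γ) (hT : 2 ≤ T) {r : ℝ}
    (h : X.avgSqNorm ≤ r) :
    ∑ t ∈ Finset.range T, ∫ ω, frobNorm (X.L t ω) ^ 2 ∂P ≤ r * T := by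
  have hT' : (0 : ℝ) < T := by positivity
  rwa [avgSqNorm, one_div_mul_eq_div, div_le_iff₀ hT'] at h

variable [IsProbabilityMeasure P]

theorem integrable_frobNorm (X : SparseRun P d T η γ) {t : ℕ} (ht : t < T) :
    Integrable (fun ω => frobNorm (X.L t ω)) P :=
  Integrable.of_bound ((X.measurable_frobNorm ht).mono (X.ℱ.le t) le_rfl).aestronglyMeasurable d
    (Filter.Eventually.of_forall fun ω => by
      rw [Real.norm_of_nonneg (frobNorm_nonneg _)]
      exact frobNorm_le_of_specNorm_le_one (X.loss_norm_le t ht ω))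

theorem integrable_frobNorm_sq (X : SparseRun P d T η γ) {t : ℕ} (ht : t < T) :
    Integrable (fun ω => frobNorm (X.L t ω) ^ 2) P :=
  Integrable.of_bound
    (((X.measurable_frobNorm ht).pow_const 2).mono (X.ℱ.le t) le_rfl).aestronglyMeasurable
    ((d : ℝ) ^ 2)
    (Filter.Eventually.of_forall fun ω => by
      rw [Real.norm_of_nonneg (sq_nonneg _)]
      exact pow_le_pow_left₀ (frobNorm_nonneg _)
        (frobNorm_le_of_specNorm_le_one (X.loss_norm_le t ht ω)) 2)

theorem integral_draw_loss (X : SparseRun P d T η γ) (hd : 1 ≤ d) {t : ℕ} (ht : t < T)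
    {v : Fin d → ℝ} (hv : v ⬝ᵥ v = 1) :
    Integrable (fun ω => frobInner (outer (X.w t ω) - outer v) (X.L t ω)) P ∧
    Integrable (fun ω => ∑ i, X.lam t ω i * (X.u t ω i ⬝ᵥ X.L t ω *ᵥ X.u t ω i) -
      v ⬝ᵥ X.L t ω *ᵥ v) P ∧
    ∫ ω, frobInner (outer (X.w t ω) - outer v) (X.L t ω) ∂P =
      ∫ ω, (∑ i, X.lam t ω i * (X.u t ω i ⬝ᵥ X.L t ω *ᵥ X.u t ω i) - v ⬝ᵥ X.L t ω *ᵥ v) ∂P := by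
  have hmeas : Measurable[X.ℱ t] fun ω => v ⬝ᵥ X.L t ω *ᵥ v := by
    simp only [dotProduct, mulVec]
    exact Finset.measurable_fun_sum _ fun p _ => (Finset.measurable_fun_sum _ fun q _ =>
      (X.loss_measurable t ht p q).mul_const _).const_mul _
  have h := X.integral_draw ht (C := 2)
    (G := fun i j b ω => sparseLoss (X.u t ω) (X.L t ω) i j b - v ⬝ᵥ X.L t ω *ᵥ v)
    (fun i j b => (X.measurable_sparseLoss ht i j b).sub hmeas) (fun i j b ω => by
      have h1 := abs_sparseLoss_le (X.eigendecomposition t ht ω).1 (X.loss_norm_le t ht ω) i j b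
      have h2 := (abs_dotProduct_mulVec_le_specNorm (X.L t ω) hv hv).trans (X.loss_norm_le t ht ω)
      refine (abs_sub _ _).trans (by linarith))
  have heq : (fun ω => ∑ i, ∑ j, ∑ b, X.lam t ω i * X.lam t ω j * (1 / 2) *
      (sparseLoss (X.u t ω) (X.L t ω) i j b - v ⬝ᵥ X.L t ω *ᵥ v)) = fun ω =>
      ∑ i, X.lam t ω i * (X.u t ω i ⬝ᵥ X.L t ω *ᵥ X.u t ω i) - v ⬝ᵥ X.L t ω *ᵥ v :=
    funext fun ω => by
      have hsum : ∑ i, ∑ j, ∑ _b : Bool, X.lam t ω i * X.lam t ω j * (1 / 2) = 1 := by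
        simp only [Finset.sum_const, Finset.card_univ, Fintype.card_bool, nsmul_eq_mul]
        have h1 := X.sum_lam hd ht ω
        calc ∑ i, ∑ j, ((2 : ℕ) : ℝ) * (X.lam t ω i * X.lam t ω j * (1 / 2)) =
            ∑ i, ∑ j, X.lam t ω i * X.lam t ω j :=
              Finset.sum_congr rfl fun i _ => Finset.sum_congr rfl fun j _ => by push_cast; ring
          _ = 1 := by rw [← Finset.sum_mul_sum, h1, one_mul]
      have hconst : ∑ i, ∑ j, ∑ _b : Bool, X.lam t ω i * X.lam t ω j * (1 / 2) *
          (v ⬝ᵥ X.L t ω *ᵥ v) = v ⬝ᵥ X.L t ω *ᵥ v := by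
        have := congrArg (· * (v ⬝ᵥ X.L t ω *ᵥ v)) hsum
        simpa only [Finset.sum_mul, one_mul] using this
      simp only [mul_sub, Finset.sum_sub_distrib]
      rw [sum_sparseLoss (X.loss_symm t ht ω) (X.sum_lam hd ht ω), hconst]
  rw [heq] at h
  simp only [frobInner_w_sub]
  exact h

/-- Two biases separate the true regret from its estimate: sampling from `lam` instead of the
eigenvalues, and comparing with the smoothed comparator instead of `v vᵀ`. -/
theorem integral_regret_le (X : SparseRun P d T η (d * η)) (hd : 1 ≤ d) (hT : 2 ≤ T)
    (hη : 0 < η) (hη' : d * η ≤ 1 / 2) {t : ℕ} (ht : t < T)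
    {v : Fin d → ℝ} (hv : v ⬝ᵥ v = 1) :
    ∫ ω, frobInner (outer (X.w t ω) - outer v) (X.L t ω) ∂P ≤
      ∫ ω, ((X.W t ω - comparator T v) * X.estimate t (X.I t ω) (X.J t ω) (X.s t ω) ω).trace ∂P +
        2 * (d * η) * ∫ ω, frobNorm (X.L t ω) ∂P + 2 / T := by
  set U := comparator T v with hU
  obtain ⟨-, h1, h2⟩ := X.integral_draw_loss hd ht hv
  obtain ⟨-, h3, h4⟩ := X.integral_draw ht
    (G := fun i j b ω => ((X.W t ω - U) * X.estimate t i j b ω).trace)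
    (X.measurable_trace_estimate ht U) (fun i j b ω => X.abs_trace_estimate_le hd hη hη' ht ω U i j b)
  have heq : (fun ω => ∑ i, ∑ j, ∑ b, X.lam t ω i * X.lam t ω j * (1 / 2) *
      ((X.W t ω - U) * X.estimate t i j b ω).trace) =
      fun ω => ((X.W t ω - U) * X.L t ω).trace :=
    funext fun ω => sum_trace_mul_sparseEstimate (X.eigendecomposition t ht ω).1
      (X.loss_symm t ht ω) _ fun i => (X.isTame hd hη hη' ht ω).pos i
  rw [heq] at h3 h4
  have hF := X.integrable_frobNorm ht
  have h5 : Integrable (fun ω => ((X.W t ω - U) * X.L t ω).trace +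
      2 * (d * η) * frobNorm (X.L t ω)) P := h3.add (hF.const_mul _)
  rw [h2, h4, ← integral_const_mul, ← integral_add h3 (hF.const_mul _)]
  have hc : (2 : ℝ) / T = ∫ _ω, (2 : ℝ) / T ∂P := by simp
  rw [hc, ← integral_add h5 (integrable_const _)]
  refine integral_mono h1 (h5.add (integrable_const _)) fun ω => ?_
  have hdec := X.eigendecomposition t ht ω
  have htame := X.isTame hd hη hη' ht ω
  have hd' : (0 : ℝ) < d := by positivity
  have hT' : (0 : ℝ) < T := by positivity
  set m : Fin d → ℝ := fun i => X.u t ω i ⬝ᵥ X.L t ω *ᵥ X.u t ω i with hm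
  have hunit : ∀ i, X.u t ω i ⬝ᵥ X.u t ω i = 1 := fun i => by rw [hdec.1, if_pos rfl]
  have hmF : ∀ i, |m i| ≤ frobNorm (X.L t ω) := fun i =>
    abs_dotProduct_mulVec_le_frobNorm _ (hunit i)
  have hm1 : ∀ i, |m i| ≤ 1 := fun i =>
    (abs_dotProduct_mulVec_le_specNorm _ (hunit i) (hunit i)).trans (X.loss_norm_le t ht ω)
  have hv1 := abs_le.1 ((abs_dotProduct_mulVec_le_specNorm (X.L t ω) hv hv).trans
    (X.loss_norm_le t ht ω))
  have htr : ((X.W t ω - U) * X.L t ω).trace = ∑ i, X.μ t ω i * m i -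
      ((1 - 1 / (T : ℝ)) * (v ⬝ᵥ X.L t ω *ᵥ v) + 1 / ((T : ℝ) * d) * ∑ i, m i) := by
    rw [Matrix.sub_mul, trace_sub, hdec.trace_mul, hU, comparator, Matrix.add_mul, trace_add,
      Matrix.smul_mul, Matrix.smul_mul, trace_smul, trace_smul, outer, trace_vecMulVec_mul,
      Matrix.one_mul, trace_eq_sum hdec.1, smul_eq_mul, smul_eq_mul]
  have hlam : ∑ i, X.lam t ω i * m i =
      ∑ i, X.μ t ω i * m i + d * η * ∑ i, (1 / d - X.μ t ω i) * m i := by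
    rw [Finset.mul_sum, ← Finset.sum_add_distrib]
    refine Finset.sum_congr rfl fun i _ => ?_
    simp only [lam, mixed]; ring
  -- The uniform weights and the eigenvalues both sum to one, whence the factor 2.
  have hbias : ∑ i, (1 / d - X.μ t ω i) * m i ≤ 2 * frobNorm (X.L t ω) := by
    calc ∑ i, (1 / d - X.μ t ω i) * m i ≤
        ∑ i, (1 / d + X.μ t ω i) * frobNorm (X.L t ω) := by
          refine Finset.sum_le_sum fun i _ => ?_
          have ha := abs_le.1 (hmF i)
          have hb := (htame.eigenvalue_pos i).le
          have hc : (0 : ℝ) ≤ 1 / d := by positivity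
          nlinarith [ha.1, ha.2]
      _ = 2 * frobNorm (X.L t ω) := by
          rw [← Finset.sum_mul, Finset.sum_add_distrib, X.sum_eigenvalues hd ht ω]
          simp; field_simp; norm_num
  have hmean : 1 / ((T : ℝ) * d) * ∑ i, m i ≤ 1 / T := by
    have : ∑ i, m i ≤ d := by
      calc ∑ i, m i ≤ ∑ _i : Fin d, (1 : ℝ) :=
            Finset.sum_le_sum fun i _ => (abs_le.1 (hm1 i)).2
        _ = d := by simp
    rw [one_div_mul_eq_div, div_le_div_iff₀ (by positivity) hT']
    nlinarith
  have hvT : -(1 / (T : ℝ) * (v ⬝ᵥ X.L t ω *ᵥ v)) ≤ 1 / T := by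
    have : 0 < 1 / (T : ℝ) := by positivity
    nlinarith [hv1.1]
  have hb2 : d * η * ∑ i, (1 / d - X.μ t ω i) * m i ≤ d * η * (2 * frobNorm (X.L t ω)) := by
    gcongr
  simp only
  rw [hlam, htr]
  have : (2 : ℝ) / T = 1 / T + 1 / T := by ring
  linarith

theorem integral_stability_le (X : SparseRun P d T η (d * η)) (hd : 1 ≤ d)
    (hη : 0 < η) (hη' : d * η ≤ 1 / 2) {t : ℕ} (ht : t < T) :
    Integrable (fun ω => stability (X.W t ω)
      (X.estimate t (X.I t ω) (X.J t ω) (X.s t ω) ω) η) P ∧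
    ∫ ω, stability (X.W t ω) (X.estimate t (X.I t ω) (X.J t ω) (X.s t ω) ω) η ∂P ≤
      4 * d * η ^ 2 * ∫ ω, frobNorm (X.L t ω) ^ 2 ∂P := by
  obtain ⟨h1, h2, h3⟩ := X.integral_draw ht (C := 1)
    (G := fun i j b ω => stability (X.W t ω) (X.estimate t i j b ω) η)
    (X.measurable_stability ht) (fun i j b ω => by
      have hdec := X.eigendecomposition t ht ω
      have h := stability_nonneg_and_le_one hdec (X.isTame hd hη hη' ht ω) i j b
        (abs_sparseLoss_le hdec.1 (X.loss_norm_le t ht ω) i j b)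
      rw [estimate, abs_of_nonneg h.1]; exact h.2)
  refine ⟨h1, ?_⟩
  rw [h3, ← integral_const_mul]
  exact integral_mono h2 ((X.integrable_frobNorm_sq ht).const_mul _) fun ω =>
    sum_stability_le (X.eigendecomposition t ht ω) (X.loss_symm t ht ω) (X.isTame hd hη hη' ht ω) hd

theorem sum_integral_regret_le (X : SparseRun P d T η (d * η)) (hd : 1 ≤ d) (hT : 2 ≤ T)
    (hη : 0 < η) (hη' : d * η ≤ 1 / 2) {v : Fin d → ℝ} (hv : v ⬝ᵥ v = 1) :
    ∑ t ∈ Finset.range T, ∫ ω, frobInner (outer (X.w t ω) - outer v) (X.L t ω) ∂P ≤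
      d * Real.log T / η + 8 * d * η * ∑ t ∈ Finset.range T, ∫ ω, frobNorm (X.L t ω) ^ 2 ∂P +
        2 * (d * η) * ∑ t ∈ Finset.range T, ∫ ω, frobNorm (X.L t ω) ∂P + 2 := by
  set U := comparator T v with hU
  have hT' : (0 : ℝ) < T := by positivity
  have htrI : ∀ t ∈ Finset.range T, Integrable (fun ω => ((X.W t ω - U) *
      X.estimate t (X.I t ω) (X.J t ω) (X.s t ω) ω).trace) P := fun t ht =>
    (X.integral_draw (Finset.mem_range.1 ht)
      (G := fun i j b ω => ((X.W t ω - U) * X.estimate t i j b ω).trace)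
      (X.measurable_trace_estimate (Finset.mem_range.1 ht) U)
      (fun i j b ω => X.abs_trace_estimate_le hd hη hη' (Finset.mem_range.1 ht) ω U i j b)).1
  have hstI : ∀ t ∈ Finset.range T, Integrable (fun ω => stability (X.W t ω)
      (X.estimate t (X.I t ω) (X.J t ω) (X.s t ω) ω) η) P := fun t ht =>
    (X.integral_stability_le hd hη hη' (Finset.mem_range.1 ht)).1
  have hround : ∑ t ∈ Finset.range T, ∫ ω, frobInner (outer (X.w t ω) - outer v) (X.L t ω) ∂P ≤
      ∑ t ∈ Finset.range T, ∫ ω, ((X.W t ω - U) *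
        X.estimate t (X.I t ω) (X.J t ω) (X.s t ω) ω).trace ∂P +
      2 * (d * η) * ∑ t ∈ Finset.range T, ∫ ω, frobNorm (X.L t ω) ∂P + 2 := by
    refine (Finset.sum_le_sum fun t ht =>
      X.integral_regret_le hd hT hη hη' (Finset.mem_range.1 ht) hv).trans_eq ?_
    rw [Finset.sum_add_distrib, Finset.sum_add_distrib, ← Finset.mul_sum, Finset.sum_const,
      Finset.card_range, nsmul_eq_mul, mul_div_cancel₀ _ hT'.ne']
  have hpath : η * ∑ t ∈ Finset.range T, ∫ ω, ((X.W t ω - U) *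
        X.estimate t (X.I t ω) (X.J t ω) (X.s t ω) ω).trace ∂P ≤
      d * Real.log T + 2 * ∑ t ∈ Finset.range T,
        ∫ ω, stability (X.W t ω) (X.estimate t (X.I t ω) (X.J t ω) (X.s t ω) ω) η ∂P := by
    rw [← integral_finsetSum _ htrI, ← integral_finsetSum _ hstI, ← integral_const_mul,
      ← integral_const_mul]
    have hc : (d * Real.log T : ℝ) = ∫ _ω, (d * Real.log T : ℝ) ∂P := by simp
    rw [hc, ← integral_add (integrable_const _) ((integrable_finsetSum _ hstI).const_mul _)]
    exact integral_mono ((integrable_finsetSum _ htrI).const_mul _)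
      ((integrable_const _).add ((integrable_finsetSum _ hstI).const_mul _))
      fun ω => X.sum_trace_estimate_le hd hT hη hη' ω hv
  have hst : ∑ t ∈ Finset.range T,
        ∫ ω, stability (X.W t ω) (X.estimate t (X.I t ω) (X.J t ω) (X.s t ω) ω) η ∂P ≤
      4 * d * η ^ 2 * ∑ t ∈ Finset.range T, ∫ ω, frobNorm (X.L t ω) ^ 2 ∂P := by
    rw [Finset.mul_sum]
    exact Finset.sum_le_sum fun t ht =>
      (X.integral_stability_le hd hη hη' (Finset.mem_range.1 ht)).2
  have hdiv : ∑ t ∈ Finset.range T, ∫ ω, ((X.W t ω - U) *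
        X.estimate t (X.I t ω) (X.J t ω) (X.s t ω) ω).trace ∂P ≤
      d * Real.log T / η + 8 * d * η * ∑ t ∈ Finset.range T, ∫ ω, frobNorm (X.L t ω) ^ 2 ∂P := by
    set S := ∑ t ∈ Finset.range T, ∫ ω, frobNorm (X.L t ω) ^ 2 ∂P
    have : d * Real.log T / η + 8 * d * η * S = (d * Real.log T + 8 * d * η ^ 2 * S) / η := by
      field_simp
    rw [this, le_div_iff₀ hη]
    linarith
  linarith

/-- The inequality `2 √r x ≤ r + x²`, integrated and summed, replaces the Cauchy-Schwarz inequality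
over rounds and over `Ω`. -/
theorem sum_integral_frobNorm_le (X : SparseRun P d T η γ) {r : ℝ} (hr : 0 < r)
    (h : ∑ t ∈ Finset.range T, ∫ ω, frobNorm (X.L t ω) ^ 2 ∂P ≤ r * T) :
    ∑ t ∈ Finset.range T, ∫ ω, frobNorm (X.L t ω) ∂P ≤ T * √r := by
  have hs : 0 < √r := Real.sqrt_pos.2 hr
  have hs2 : √r * √r = r := Real.mul_self_sqrt hr.le
  have key : ∀ t ∈ Finset.range T, 2 * √r * ∫ ω, frobNorm (X.L t ω) ∂P ≤
      r + ∫ ω, frobNorm (X.L t ω) ^ 2 ∂P := fun t ht => by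
    have ht := Finset.mem_range.1 ht
    have hc : r = ∫ _ω, r ∂P := by simp
    rw [← integral_const_mul, hc, ← integral_add (integrable_const _) (X.integrable_frobNorm_sq ht),
      ← hc]
    exact integral_mono ((X.integrable_frobNorm ht).const_mul _)
      ((integrable_const _).add (X.integrable_frobNorm_sq ht)) fun ω => by
        simp only
        nlinarith [sq_nonneg (√r - frobNorm (X.L t ω))]
  have hsum := Finset.sum_le_sum key
  rw [← Finset.mul_sum, Finset.sum_add_distrib, Finset.sum_const, Finset.card_range,
    nsmul_eq_mul] at hsum
  refine le_of_mul_le_mul_left ?_ (mul_pos two_pos hs)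
  calc _ ≤ _ := hsum
    _ ≤ T * r + r * T := by gcongr
    _ = 2 * √r * (T * √r) := by linear_combination (-2 * T : ℝ) * hs2

theorem regret_le (hd : 1 ≤ d) (hT : 2 ≤ T) {r : ℝ} (hr : 0 < r)
    (X : SparseRun P d T (learningRate d T r) (d * learningRate d T r)) (h : X.avgSqNorm ≤ r) :
    X.regret ≤ 9 * (d * √(r * T * Real.log T)) + 4 * (d * √(T * Real.log T)) := by
  have hd1 : (1 : ℝ) ≤ d := by exact_mod_cast hd
  have hT2 : (2 : ℝ) ≤ T := by exact_mod_cast hT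
  have hT0 : (0 : ℝ) < T := by linarith
  have hlog2 : (1 / 2 : ℝ) ≤ Real.log T := by
    have := Real.log_two_gt_d9
    have := Real.log_le_log (by norm_num) hT2
    linarith
  have hlog : 0 < Real.log T := by linarith
  have hS := X.sum_integral_sq_le hT h
  have hF := X.sum_integral_frobNorm_le hr hS
  set S := ∑ t ∈ Finset.range T, ∫ ω, frobNorm (X.L t ω) ^ 2 ∂P
  set F := ∑ t ∈ Finset.range T, ∫ ω, frobNorm (X.L t ω) ∂P with hFdef
  have hne : Nonempty {v : Fin d → ℝ // v ⬝ᵥ v = 1} := ⟨⟨Pi.single ⟨0, hd⟩ 1, by simp⟩⟩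
  refine ciSup_le fun ⟨v, hv⟩ => ?_
  set x := √r
  set z := √(T : ℝ)
  set y := √(Real.log T)
  have hx : 0 < x := Real.sqrt_pos.2 hr
  have hz : 0 < z := Real.sqrt_pos.2 hT0
  have hy : 0 < y := Real.sqrt_pos.2 hlog
  have hx2 : x * x = r := Real.mul_self_sqrt hr.le
  have hz2 : z * z = T := Real.mul_self_sqrt hT0.le
  have hy2 : y * y = Real.log T := Real.mul_self_sqrt hlog.le
  have e1 : √(r * T * Real.log T) = x * z * y := by
    rw [Real.sqrt_mul (by positivity), Real.sqrt_mul hr.le]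
  have e2 : √(T * Real.log T) = z * y := Real.sqrt_mul hT0.le _
  have e3 : √(Real.log T / (r * T)) = y / (x * z) := by
    rw [Real.sqrt_div hlog.le, Real.sqrt_mul hr.le]
  -- `T log T ≥ 1` holds since `T ≥ 2` and `log T ≥ 1 / 2`; it lets `d √(T log T)` absorb the
  -- additive constant 2.
  have hzy : 1 ≤ z * y := by
    rw [← e2, Real.one_le_sqrt]; nlinarith
  rw [e1, e2]
  have hηpos : 0 < learningRate d T r := by
    rw [learningRate, e3]; positivity
  have hη' : d * learningRate d T r ≤ 1 / 2 := by
    calc d * learningRate d T r ≤ d * (1 / (2 * (d : ℝ))) := by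
          gcongr; exact min_le_right _ _
      _ = 1 / 2 := by field_simp
  rcases le_total (√(Real.log T / (r * T))) (1 / (2 * (d : ℝ))) with hcase | hcase
  · have hη : learningRate d T r = y / (x * z) := by rw [learningRate, min_eq_left hcase, e3]
    have hmain := X.sum_integral_regret_le hd hT hηpos hη' hv
    refine hmain.trans ?_
    have h1 : d * Real.log T / learningRate d T r = d * (x * z * y) := by
      rw [hη, ← hy2]; field_simp
    have h2 : 8 * d * learningRate d T r * S ≤ 8 * (d * (x * z * y)) := by
      calc 8 * d * learningRate d T r * S ≤ 8 * d * learningRate d T r * (r * T) := by gcongr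
        _ = 8 * (d * (x * z * y)) := by rw [hη, ← hx2, ← hz2]; field_simp
    have h3 : 2 * (d * learningRate d T r) * F ≤ 2 * (d * (z * y)) := by
      calc 2 * (d * learningRate d T r) * F ≤ 2 * (d * learningRate d T r) * (T * x) := by gcongr
        _ = 2 * (d * (z * y)) := by rw [hη, ← hz2]; field_simp
    have h4 : 1 ≤ d * (z * y) := by nlinarith
    rw [h1]
    linarith
  -- Here the rate is capped at `1 / (2 d)`, and `hcase` amounts to `√(r T) ≤ 2 d √(log T)`, so
  -- bounding each round by `2 ‖L‖_F` is enough.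
  · have htriv : ∑ t ∈ Finset.range T, ∫ ω, frobInner (outer (X.w t ω) - outer v) (X.L t ω) ∂P ≤
        2 * F := by
      rw [hFdef, Finset.mul_sum]
      refine Finset.sum_le_sum fun t ht => ?_
      have ht := Finset.mem_range.1 ht
      rw [← integral_const_mul]
      exact integral_mono (X.integral_draw_loss hd ht hv).1 ((X.integrable_frobNorm ht).const_mul _)
        fun ω => X.frobInner_w_sub_le ht ω hv
    refine htriv.trans ?_
    rw [e3, div_le_div_iff₀ (by positivity) (by positivity)] at hcase
    have h1 : 2 * (T * x) ≤ 4 * (d * (z * y)) := by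
      rw [← hz2]; nlinarith
    have h2 : 0 ≤ d * (x * z * y) := by positivity
    linarith

end SparseRun

end BanditPCA

theorem corollary3 :
    ∃ C : ℝ, 0 < C ∧
      ∀ (d T : ℕ), 1 ≤ d → 2 ≤ T →
      ∀ (Ω : Type*) [MeasurableSpace Ω] (P : Measure Ω) [IsProbabilityMeasure P],
        (∀ r : ℝ, 0 < r →
          ∀ X : BanditPCA.SparseRun P d T
              (BanditPCA.learningRate d T r) (d * BanditPCA.learningRate d T r),
            X.avgSqNorm ≤ r →
            (1 ≤ r → X.regret ≤ C * (d * Real.sqrt (r * T * Real.log T))) ∧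
            (r < 1 → X.regret ≤ C * (d * Real.sqrt (T * Real.log T)))) ∧
        (∀ X : BanditPCA.SparseRun P d T
            (BanditPCA.learningRate d T 1) (d * BanditPCA.learningRate d T 1),
          (∀ t < T, ∀ ω, (X.L t ω).rank ≤ 1) →
          X.regret ≤ C * (d * Real.sqrt (T * Real.log T))) := by
  -- `13 = 9 + 4`: the larger of the two square roots in `regret_le` depends on whether `r ≥ 1`.
  refine ⟨13, by norm_num, fun d T hd hT Ω _ P _ => ?_⟩
  have main : ∀ r : ℝ, 0 < r → ∀ X : BanditPCA.SparseRun P d T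
      (BanditPCA.learningRate d T r) (d * BanditPCA.learningRate d T r), X.avgSqNorm ≤ r →
      (1 ≤ r → X.regret ≤ 13 * (d * Real.sqrt (r * T * Real.log T))) ∧
      (r < 1 → X.regret ≤ 13 * (d * Real.sqrt (T * Real.log T))) := by
    intro r hr X hX
    have h := BanditPCA.SparseRun.regret_le hd hT hr X hX
    have hlog : 0 ≤ Real.log T := Real.log_natCast_nonneg T
    refine ⟨fun h1 => ?_, fun h1 => ?_⟩
    · have : d * Real.sqrt (T * Real.log T) ≤ d * Real.sqrt (r * T * Real.log T) := by
        gcongr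
        exact le_mul_of_one_le_left (by positivity) h1
      linarith
    · have : d * Real.sqrt (r * T * Real.log T) ≤ d * Real.sqrt (T * Real.log T) := by
        gcongr
        exact mul_le_of_le_one_left (by positivity) h1.le
      linarith
  refine ⟨main, fun X hX => ?_⟩
  have havg : X.avgSqNorm ≤ 1 := by
    have hT' : (0 : ℝ) < T := by positivity
    rw [BanditPCA.SparseRun.avgSqNorm, one_div_mul_eq_div, div_le_one hT']
    calc ∑ t ∈ Finset.range T, ∫ ω, BanditPCA.frobNorm (X.L t ω) ^ 2 ∂P
        ≤ ∑ _t ∈ Finset.range T, (1 : ℝ) := by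
          refine Finset.sum_le_sum fun t ht => ?_
          have ht := Finset.mem_range.1 ht
          have hc : (1 : ℝ) = ∫ _ω, (1 : ℝ) ∂P := by simp
          refine le_of_le_of_eq ?_ hc.symm
          exact integral_mono (X.integrable_frobNorm_sq ht) (integrable_const _) fun ω =>
            BanditPCA.frobNorm_sq_le_one_of_rank_le_one (X.loss_symm t ht ω)
              (X.loss_norm_le t ht ω) (hX t ht ω)
      _ = T := by simp
  simpa using (main 1 one_pos X havg).1 le_rfl
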